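/- GPC (Graph Pattern Calculus) path patterns over property graphs are built from node patterns $(x:\ell)$ and forward or backward edge patterns (the variable $x$ and the label $\ell$ being optional) by union, concatenation, conditioning $\pi_{\langle\theta\rangle}$ and repetition $\pi^{n..m}$ with $n \le m \le \infty$, where conditions $\theta$ are Boolean combinations of atoms $x.a = c$ and $x.a = y.b$ (an atom holds only if the properties in it are defined). Queries are path patterns qualified by a restrictor $\rho\in\{\mathsf{simple},\mathsf{trail},\mathsf{shortest}\}$, closed under joins and conditioning. The satisfiability problem is: given a well-typed query $Q$, written as a word over a finite alphabet, decide whether there is a (finite) property graph $G$ on which $Q$ has a non-empty set of answers. The satisfiability problem for GPC is NP-hard under polynomial-time many-one reductions, and it remains NP-hard even for single-node patterns: for each fixed restrictor $\rho\in\{\mathsf{simple},\mathsf{trail},\mathsf{shortest}\}$, the satisfiability problem restricted to the well-typed queries of the form $\rho\,(x:\ell)_{\langle\theta\rangle}$, with $\ell$ optional, is NP-hard. -/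

import Mathlib

/-! ## Polynomial-time reductions and NP-hardness -/

namespace Complexity

/-- `L` is in NP: membership has certificates of polynomial length (bit strings) that are
checked by a polynomial-time Turing machine. The machine model is Mathlib's `Turing.FinTM2`; the
pair (word, certificate) is written as one word over the disjoint union of the two alphabets. -/
def InNP {Γ : Type} (L : Language Γ) : Prop :=
  ∃ (R : List Γ × List Bool → Bool) (p : Polynomial ℕ),
    Nonempty (Turing.TM2ComputableInPolyTime
      (Computability.encodingProd (Computability.encodingList Γ)
        (Computability.encodingList Bool)).encode
      Computability.encodeBool R) ∧
    ∀ w : List Γ, w ∈ L ↔ ∃ y : List Bool, y.length ≤ p.eval w.length ∧ R (w, y) = true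

/-- The decision problem "given `a : α`, is `a ∈ S`?", whose instances are written as words over a finite alphabet by
`enc`, is NP-hard: every language in NP, over any finite alphabet, has a polynomial-time many-one
reduction to it. -/
def NPHard {α A : Type} [Fintype A] (enc : α → List A) (S : Set α) : Prop :=
  ∀ (Γ : Type) [Fintype Γ] (L : Language Γ), InNP L →
    ∃ f : List Γ → α,
      Nonempty (Turing.TM2ComputableInPolyTime (id : List Γ → List Γ) enc f) ∧
      ∀ w : List Γ, w ∈ L ↔ f w ∈ S

end Complexity

namespace GPC

/-! ## Property graphs -/

/-- Object identifiers (node ids and edge ids). -/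
abbrev Obj := ℕ

/-- Labels are arbitrary bit strings. -/
structure Label where
  name : List Bool
  deriving DecidableEq

/-- Keys (property names) are arbitrary bit strings. -/
structure Key where
  name : List Bool
  deriving DecidableEq

/-- Constants (data values) are arbitrary bit strings. -/
structure Const where
  name : List Bool
  deriving DecidableEq

/-- Variables are arbitrary bit strings. -/
structure Var where
  name : List Bool
  deriving DecidableEq

/-- Property graphs. The functions `src`, `tgt` matter only on edges and `labels` only on nodes and
edges. The partial function `prop` is defined at `(o, a)` when its value is not `none`. -/
structure PropertyGraph where
  nodes : Finset Obj
  edges : Finset Obj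
  disjoint : Disjoint nodes edges
  labels : Obj → Finset Label
  src : Obj → Obj
  tgt : Obj → Obj
  src_mem : ∀ e ∈ edges, src e ∈ nodes
  tgt_mem : ∀ e ∈ edges, tgt e ∈ nodes
  prop : Obj → Key → Option Const
  prop_mem : ∀ o a, prop o a ≠ none → o ∈ nodes ∪ edges
  prop_finite : {q : Obj × Key | prop q.1 q.2 ≠ none}.Finite

/-- An alternating sequence `n₀, e₁, n₁, …, eₖ, nₖ`, stored as `n₀` and the list of the pairs
`(eᵢ, nᵢ)`. -/
structure Path where
  first : Obj
  steps : List (Obj × Obj)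

namespace Path

/-- The list `n₀, …, nₖ`. -/
def nodeList (p : Path) : List Obj := p.first :: p.steps.map Prod.snd

/-- The list `e₁, …, eₖ`. -/
def edgeList (p : Path) : List Obj := p.steps.map Prod.fst

/-- The last node `nₖ`. -/
def last (p : Path) : Obj := p.nodeList.getLast (by simp [nodeList])

/-- The number of edges. -/
def len (p : Path) : ℕ := p.steps.length

/-- Concatenation, meaningful when `p.last = q.first`. -/
def append (p q : Path) : Path := ⟨p.first, p.steps ++ q.steps⟩

end Path

/-! ## Syntax -/

/-- The optional variable and the optional label of a node or edge pattern. -/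
structure Descriptor where
  var : Option Var
  label : Option Label

inductive Direction
  | forward
  | backward

/-- Conditions: Boolean combinations of `x.a = c` and `x.a = y.b`. -/
inductive Cond
  | eqConst (x : Var) (a : Key) (c : Const)
  | eqProp (x : Var) (a : Key) (y : Var) (b : Key)
  | and (θ₁ θ₂ : Cond)
  | or (θ₁ θ₂ : Cond)
  | not (θ : Cond)

/-- Path patterns. In `rep π n m` the upper bound `m = none` stands for `∞`. -/
inductive Pattern
  | node (d : Descriptor)
  | edge (dir : Direction) (d : Descriptor)
  | union (π₁ π₂ : Pattern)
  | concat (π₁ π₂ : Pattern)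
  | cond (π : Pattern) (θ : Cond)
  | rep (π : Pattern) (n : ℕ) (m : Option ℕ)

inductive Restrictor
  | simple
  | trail
  | shortest

/-- Graph patterns (queries): path patterns qualified with a restrictor, joins, and conditions on
top of them. -/
inductive Query
  | path (ρ : Restrictor) (π : Pattern)
  | join (Q₁ Q₂ : Query)
  | cond (Q : Query) (θ : Cond)

/-! ## Type system -/

inductive Ty
  | node
  | edge
  | maybe (τ : Ty)
  | group (τ : Ty)
  deriving DecidableEq

/-- Singleton variables are those of type `node` or `edge`. -/
def Ty.IsSingleton (τ : Ty) : Prop := τ = .node ∨ τ = .edge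

/-- `maybe τ`, without nesting `maybe`. -/
def Ty.toMaybe : Ty → Ty
  | .maybe τ => .maybe τ
  | τ => .maybe τ

/-- A schema gives a type to the variables that occur in an expression. -/
abbrev Schema := Var → Option Ty

/-- All variables of the condition are singleton variables in schema `s`. -/
def Cond.WellTyped (s : Schema) : Cond → Prop
  | .eqConst x _ _ => ∃ τ, s x = some τ ∧ τ.IsSingleton
  | .eqProp x _ y _ => (∃ τ, s x = some τ ∧ τ.IsSingleton) ∧ ∃ τ, s y = some τ ∧ τ.IsSingleton
  | .and θ₁ θ₂ => θ₁.WellTyped s ∧ θ₂.WellTyped s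
  | .or θ₁ θ₂ => θ₁.WellTyped s ∧ θ₂.WellTyped s
  | .not θ => θ.WellTyped s

def Descriptor.schema (d : Descriptor) (τ : Ty) : Schema :=
  fun x => if d.var = some x then some τ else none

/-- A variable that occurs in only one disjunct, or is optional in one of them, is optional. -/
def unionType : Option Ty → Option Ty → Option Ty
  | none, none => none
  | some τ, none => some τ.toMaybe
  | none, some τ => some τ.toMaybe
  | some τ₁, some τ₂ => if τ₁ = τ₂ then some τ₁ else some τ₁.toMaybe

/-- Only singleton variables, of the same type on both sides, can be joined. -/
def Schema.Joinable (s₁ s₂ : Schema) : Prop :=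
  ∀ x τ₁ τ₂, s₁ x = some τ₁ → s₂ x = some τ₂ → τ₁ = τ₂ ∧ τ₁.IsSingleton

/-- The types assigned by the typing rules (meaningful for well-typed patterns). -/
def Pattern.schema : Pattern → Schema
  | .node d => d.schema .node
  | .edge _ d => d.schema .edge
  | .union π₁ π₂ => fun x => unionType (π₁.schema x) (π₂.schema x)
  | .concat π₁ π₂ => fun x => (π₁.schema x).or (π₂.schema x)
  | .cond π _ => π.schema
  | .rep π _ _ => fun x => (π.schema x).map .group

def Pattern.WellTyped : Pattern → Prop
  | .node _ => True
  | .edge _ _ => True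
  | .union π₁ π₂ => π₁.WellTyped ∧ π₂.WellTyped ∧
      ∀ x τ₁ τ₂, π₁.schema x = some τ₁ → π₂.schema x = some τ₂ → τ₁.toMaybe = τ₂.toMaybe
  | .concat π₁ π₂ => π₁.WellTyped ∧ π₂.WellTyped ∧ π₁.schema.Joinable π₂.schema
  | .cond π θ => π.WellTyped ∧ θ.WellTyped π.schema
  | .rep π n m => π.WellTyped ∧ ∀ k, m = some k → n ≤ k

def Query.schema : Query → Schema
  | .path _ π => π.schema
  | .join Q₁ Q₂ => fun x => (Q₁.schema x).or (Q₂.schema x)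
  | .cond Q _ => Q.schema

def Query.WellTyped : Query → Prop
  | .path _ π => π.WellTyped
  | .join Q₁ Q₂ => Q₁.WellTyped ∧ Q₂.WellTyped ∧ Q₁.schema.Joinable Q₂.schema
  | .cond Q θ => Q.WellTyped ∧ θ.WellTyped Q.schema

/-! ## Semantics -/

/-- Bindings of variables to graph elements. Group variables, and optional variables that were not
matched, are left unbound. -/
abbrev Binding := Var → Option Obj

/-- The two bindings agree on the variables that both of them bind. -/
def Binding.Compatible (μ₁ μ₂ : Binding) : Prop :=
  ∀ x o₁ o₂, μ₁ x = some o₁ → μ₂ x = some o₂ → o₁ = o₂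

def Binding.union (μ₁ μ₂ : Binding) : Binding := fun x => (μ₁ x).or (μ₂ x)

/-- The binding of the variable of `d`, if there is one, to `o`. -/
def Descriptor.bind (d : Descriptor) (o : Obj) : Binding :=
  fun x => if d.var = some x then some o else none

/-- The element `o` has the label required by `d`, if there is one. -/
def Descriptor.LabelOk (d : Descriptor) (G : PropertyGraph) (o : Obj) : Prop :=
  ∀ l, d.label = some l → l ∈ G.labels o

/-- Satisfaction of a condition. An equality holds only if both of its sides are defined. -/
def Cond.Holds (G : PropertyGraph) (μ : Binding) : Cond → Prop
  | .eqConst x a c => ∃ o, μ x = some o ∧ G.prop o a = some c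
  | .eqProp x a y b => ∃ o o' c, μ x = some o ∧ μ y = some o' ∧
      G.prop o a = some c ∧ G.prop o' b = some c
  | .and θ₁ θ₂ => θ₁.Holds G μ ∧ θ₂.Holds G μ
  | .or θ₁ θ₂ => θ₁.Holds G μ ∨ θ₂.Holds G μ
  | .not θ => ¬ θ.Holds G μ

/-- Concatenations of `i` paths from `S`; for `i = 0` these are the single-node paths. -/
def pathPower (G : PropertyGraph) (S : Set Path) : ℕ → Set Path
  | 0 => {p | p.first ∈ G.nodes ∧ p.steps = []}
  | i + 1 => {p | ∃ q ∈ S, ∃ r ∈ pathPower G S i, q.last = r.first ∧ p = q.append r}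

/-- The matches of a path pattern: a path together with a binding. -/
def Pattern.eval (G : PropertyGraph) : Pattern → Set (Path × Binding)
  | .node d => {r | ∃ n ∈ G.nodes, d.LabelOk G n ∧ r = (⟨n, []⟩, d.bind n)}
  | .edge .forward d =>
      {r | ∃ e ∈ G.edges, d.LabelOk G e ∧ r = (⟨G.src e, [(e, G.tgt e)]⟩, d.bind e)}
  | .edge .backward d =>
      {r | ∃ e ∈ G.edges, d.LabelOk G e ∧ r = (⟨G.tgt e, [(e, G.src e)]⟩, d.bind e)}
  | .union π₁ π₂ => π₁.eval G ∪ π₂.eval G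
  | .concat π₁ π₂ => {r | ∃ r₁ ∈ π₁.eval G, ∃ r₂ ∈ π₂.eval G,
      r₁.1.last = r₂.1.first ∧ Binding.Compatible r₁.2 r₂.2 ∧
      r = (r₁.1.append r₂.1, Binding.union r₁.2 r₂.2)}
  | .cond π θ => {r | r ∈ π.eval G ∧ θ.Holds G r.2}
  | .rep π n m => {r | ∃ i, n ≤ i ∧ (∀ k, m = some k → i ≤ k) ∧
      r.1 ∈ pathPower G (Prod.fst '' π.eval G) i ∧ r.2 = fun _ => none}

/-- The matches in `S` that the restrictor keeps: no repeated node, no repeated edge, or minimal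
length among the matches in `S` with the same endpoints. -/
def Restrictor.filter (S : Set (Path × Binding)) : Restrictor → Set (Path × Binding)
  | .simple => {r | r ∈ S ∧ r.1.nodeList.Nodup}
  | .trail => {r | r ∈ S ∧ r.1.edgeList.Nodup}
  | .shortest => {r | r ∈ S ∧
      ∀ r' ∈ S, r'.1.first = r.1.first → r'.1.last = r.1.last → r.1.len ≤ r'.1.len}

/-- The bindings matched by a query. -/
def Query.eval (G : PropertyGraph) : Query → Set Binding
  | .path ρ π => Prod.snd '' ρ.filter (π.eval G)
  | .join Q₁ Q₂ => {μ | ∃ μ₁ ∈ Q₁.eval G, ∃ μ₂ ∈ Q₂.eval G,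
      Binding.Compatible μ₁ μ₂ ∧ μ = Binding.union μ₁ μ₂}
  | .cond Q θ => {μ | μ ∈ Q.eval G ∧ θ.Holds G μ}

open Classical in
/-- The answers of a query on `G`: the matched bindings, restricted to singleton variables. -/
noncomputable def Query.answers (G : PropertyGraph) (Q : Query) : Set Binding :=
  (fun μ x => if ∃ τ, Q.schema x = some τ ∧ τ.IsSingleton then μ x else none) '' Q.eval G

/-- The query has an answer on some property graph. -/
def Query.Satisfiable (Q : Query) : Prop := ∃ G : PropertyGraph, (Q.answers G).Nonempty

/-- `Q` is a well-typed query that consists of a single node pattern with a condition, under the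
restrictor `ρ`. -/
def Query.IsSingleNode (ρ : Restrictor) (Q : Query) : Prop :=
  Q.WellTyped ∧ ∃ (d : Descriptor) (θ : Cond), Q = .path ρ (.cond (.node d) θ)

/-! ## Queries as words

Queries are written in prefix notation over a finite alphabet. Names are written out bit by bit and
repetition bounds are written in binary. -/

inductive Token
  | bit (b : Bool)
  | close
  | absent
  | present
  | node
  | forward
  | backward
  | union
  | concat
  | cond
  | rep
  | eqConst
  | eqProp
  | and
  | or
  | not
  | simple
  | trail
  | shortest
  | join
  | filter
  deriving DecidableEq, Fintype

def encodeBits (l : List Bool) : List Token := l.map .bit ++ [.close]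

def encodeOption : Option (List Bool) → List Token
  | none => [.absent]
  | some l => .present :: encodeBits l

def Descriptor.encode (d : Descriptor) : List Token :=
  encodeOption (d.var.map Var.name) ++ encodeOption (d.label.map Label.name)

def Cond.encode : Cond → List Token
  | .eqConst x a c => .eqConst :: (encodeBits x.name ++ encodeBits a.name ++ encodeBits c.name)
  | .eqProp x a y b => .eqProp ::
      (encodeBits x.name ++ encodeBits a.name ++ encodeBits y.name ++ encodeBits b.name)
  | .and θ₁ θ₂ => .and :: (θ₁.encode ++ θ₂.encode)
  | .or θ₁ θ₂ => .or :: (θ₁.encode ++ θ₂.encode)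
  | .not θ => .not :: θ.encode

def Pattern.encode : Pattern → List Token
  | .node d => .node :: d.encode
  | .edge .forward d => .forward :: d.encode
  | .edge .backward d => .backward :: d.encode
  | .union π₁ π₂ => .union :: (π₁.encode ++ π₂.encode)
  | .concat π₁ π₂ => .concat :: (π₁.encode ++ π₂.encode)
  | .cond π θ => .cond :: (π.encode ++ θ.encode)
  | .rep π n m => .rep :: (π.encode ++ encodeBits n.bits ++ encodeOption (m.map Nat.bits))

def Query.encode : Query → List Token
  | .path .simple π => .simple :: π.encode
  | .path .trail π => .trail :: π.encode
  | .path .shortest π => .shortest :: π.encode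
  | .join Q₁ Q₂ => .join :: (Q₁.encode ++ Q₂.encode)
  | .cond Q θ => .filter :: (Q.encode ++ θ.encode)

/-! The encoding is unambiguous. -/

theorem encodeBits_inj : ∀ {l l' : List Bool} {s t : List Token},
    encodeBits l ++ s = encodeBits l' ++ t → l = l' ∧ s = t
  | [], [], s, t, h => by simpa [encodeBits] using h
  | [], b :: l', s, t, h => by simp [encodeBits] at h
  | b :: l, [], s, t, h => by simp [encodeBits] at h
  | b :: l, b' :: l', s, t, h => by
      have h' : b = b' ∧ encodeBits l ++ s = encodeBits l' ++ t := by
        simpa [encodeBits] using h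
      obtain ⟨rfl, h₂⟩ := h'
      obtain ⟨rfl, rfl⟩ := encodeBits_inj h₂
      exact ⟨rfl, rfl⟩

theorem encodeOption_inj {o o' : Option (List Bool)} {s t : List Token}
    (h : encodeOption o ++ s = encodeOption o' ++ t) : o = o' ∧ s = t := by
  cases o <;> cases o' <;> simp [encodeOption] at h ⊢
  · exact h
  · exact encodeBits_inj h

theorem nat_bits_injective : Function.Injective Nat.bits := by
  intro m n h
  have h' := congrArg (List.foldr Nat.bit 0) h
  have key : ∀ k : ℕ, List.foldr Nat.bit 0 k.bits = k := by
    intro k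
    induction k using Nat.binaryRec' with
    | zero => simp
    | bit b k hk ih => rw [Nat.bits_append_bit _ _ hk, List.foldr_cons, ih]
  rwa [key, key] at h'

theorem Descriptor.encode_inj {d d' : Descriptor} {s t : List Token}
    (h : d.encode ++ s = d'.encode ++ t) : d = d' ∧ s = t := by
  obtain ⟨x, l⟩ := d
  obtain ⟨x', l'⟩ := d'
  simp only [Descriptor.encode, List.append_assoc] at h
  obtain ⟨h₁, h₂⟩ := encodeOption_inj h
  obtain ⟨h₂, h₃⟩ := encodeOption_inj h₂
  have hv : Function.Injective Var.name := fun a b h => by cases a; cases b; simp_all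
  have hl : Function.Injective Label.name := fun a b h => by cases a; cases b; simp_all
  obtain rfl := Option.map_injective hv h₁
  obtain rfl := Option.map_injective hl h₂
  exact ⟨rfl, h₃⟩

theorem Cond.encode_inj {θ θ' : Cond} {s t : List Token}
    (h : θ.encode ++ s = θ'.encode ++ t) : θ = θ' ∧ s = t := by
  induction θ generalizing θ' s t with
  | eqConst x a c =>
    cases θ' <;> simp [Cond.encode] at h
    obtain ⟨h₁, ha⟩ := encodeBits_inj h
    obtain ⟨h₂, hb⟩ := encodeBits_inj ha
    obtain ⟨h₃, hc⟩ := encodeBits_inj hb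
    cases x; cases a; cases c
    simp_all
  | eqProp x a y b =>
    cases θ' <;> simp [Cond.encode] at h
    obtain ⟨h₁, ha⟩ := encodeBits_inj h
    obtain ⟨h₂, hb⟩ := encodeBits_inj ha
    obtain ⟨h₃, hc⟩ := encodeBits_inj hb
    obtain ⟨h₄, hd⟩ := encodeBits_inj hc
    cases x; cases a; cases y; cases b
    simp_all
  | and θ₁ θ₂ ih₁ ih₂ =>
    cases θ' <;> simp [Cond.encode] at h
    obtain ⟨rfl, ha⟩ := ih₁ h
    obtain ⟨rfl, hb⟩ := ih₂ ha
    exact ⟨rfl, hb⟩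
  | or θ₁ θ₂ ih₁ ih₂ =>
    cases θ' <;> simp [Cond.encode] at h
    obtain ⟨rfl, ha⟩ := ih₁ h
    obtain ⟨rfl, hb⟩ := ih₂ ha
    exact ⟨rfl, hb⟩
  | not θ ih =>
    cases θ' <;> simp [Cond.encode] at h
    obtain ⟨rfl, ha⟩ := ih h
    exact ⟨rfl, ha⟩

theorem Pattern.encode_inj {π π' : Pattern} {s t : List Token}
    (h : π.encode ++ s = π'.encode ++ t) : π = π' ∧ s = t := by
  induction π generalizing π' s t with
  | node d =>
    rcases π' with _ | ⟨_ | _, _⟩ | _ | _ | _ | _ <;> simp [Pattern.encode] at h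
    obtain ⟨rfl, ha⟩ := Descriptor.encode_inj h
    exact ⟨rfl, ha⟩
  | edge dir d =>
    rcases dir <;> rcases π' with _ | ⟨_ | _, _⟩ | _ | _ | _ | _ <;>
      simp [Pattern.encode] at h <;>
      (obtain ⟨rfl, ha⟩ := Descriptor.encode_inj h; exact ⟨rfl, ha⟩)
  | union π₁ π₂ ih₁ ih₂ =>
    rcases π' with _ | ⟨_ | _, _⟩ | _ | _ | _ | _ <;> simp [Pattern.encode] at h
    obtain ⟨rfl, ha⟩ := ih₁ h
    obtain ⟨rfl, hb⟩ := ih₂ ha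
    exact ⟨rfl, hb⟩
  | concat π₁ π₂ ih₁ ih₂ =>
    rcases π' with _ | ⟨_ | _, _⟩ | _ | _ | _ | _ <;> simp [Pattern.encode] at h
    obtain ⟨rfl, ha⟩ := ih₁ h
    obtain ⟨rfl, hb⟩ := ih₂ ha
    exact ⟨rfl, hb⟩
  | cond π θ ih =>
    rcases π' with _ | ⟨_ | _, _⟩ | _ | _ | _ | _ <;> simp [Pattern.encode] at h
    obtain ⟨rfl, ha⟩ := ih h
    obtain ⟨rfl, hb⟩ := Cond.encode_inj ha
    exact ⟨rfl, hb⟩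
  | rep π n m ih =>
    rcases π' with _ | ⟨_ | _, _⟩ | _ | _ | _ | _ <;> simp [Pattern.encode] at h
    obtain ⟨rfl, ha⟩ := ih h
    obtain ⟨h₁, hb⟩ := encodeBits_inj ha
    obtain ⟨h₂, hc⟩ := encodeOption_inj hb
    obtain rfl := nat_bits_injective h₁
    obtain rfl := Option.map_injective nat_bits_injective h₂
    exact ⟨rfl, hc⟩

theorem Query.encode_inj {Q Q' : Query} {s t : List Token}
    (h : Q.encode ++ s = Q'.encode ++ t) : Q = Q' ∧ s = t := by
  induction Q generalizing Q' s t with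
  | path ρ π =>
    rcases ρ <;> rcases Q' with ⟨_ | _ | _, _⟩ | _ | _ <;>
      simp [Query.encode] at h <;>
      (obtain ⟨rfl, ha⟩ := Pattern.encode_inj h; exact ⟨rfl, ha⟩)
  | join Q₁ Q₂ ih₁ ih₂ =>
    rcases Q' with ⟨_ | _ | _, _⟩ | _ | _ <;> simp [Query.encode] at h
    obtain ⟨rfl, ha⟩ := ih₁ h
    obtain ⟨rfl, hb⟩ := ih₂ ha
    exact ⟨rfl, hb⟩
  | cond Q θ ih =>
    rcases Q' with ⟨_ | _ | _, _⟩ | _ | _ <;> simp [Query.encode] at h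
    obtain ⟨rfl, ha⟩ := ih h
    obtain ⟨rfl, hb⟩ := Cond.encode_inj ha
    exact ⟨rfl, hb⟩

theorem Query.encode_injective : Function.Injective Query.encode := fun Q Q' h =>
  (Query.encode_inj (s := []) (t := []) (by rw [h])).1

end GPC

/-! This is the Cook–Levin argument carried out inside the properties of one node. A match of a node
pattern has no edges, so no restrictor ever discards it, and satisfiability of the query is
satisfiability of the condition. The conditions used are negation-free, so undefined properties may
be given an arbitrary value and a total valuation of the properties is all that matters
(`PForm.satisfiable_query_iff`).

A valuation encodes a computation tableau of a verifier. The property indexed by `(κ, t, j)` holds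
the symbol at depth `j`, counted from the top, of stack `κ` at time `t`; `κ = 0` is the control
state. A push or a pop then shifts a whole stack, which atoms `x.a = x.b` express cell by cell
without naming symbols. A pop brings up a cell from one level deeper, so knowing the initial row to
depth `T` determines row `t` to depth `T - t`, which still includes the top of each stack at time
`T` (`Flow.Coding.Row.iterate`); conversely an actual run satisfies every step formula
(`Flow.Coding.holds_step_run`). A step of a `TM2` machine may execute a long statement, so it is
first split into primitive stack operations, at the price of a constant factor
(`iterate_next_of_halts`). The certificate cells are left free except for having the shape of a
short bit string, whence `Verifier.holds_formula_iff`.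

The map from words to queries must itself run on a Turing machine in polynomial time. It is written
in a small loop language with unary counters whose semantics counts machine steps (`Exec.sound`,
`Prog.computable`). Property names are in unary, so counters can be printed directly into the query,
and prefix notation lets conjuncts be prepended one by one (`Verifier.exists_prog`). -/

namespace CookLevin

open Turing GPC

/-! ## A loop language compiled to Turing machines -/

/-- Counters of the loop language. -/
inductive Reg
  | len | cert | time | width | row | col | tmp | aux
  deriving DecidableEq

instance : Fintype Reg :=
  ⟨{.len, .cert, .time, .width, .row, .col, .tmp, .aux}, fun r => by cases r <;> decide⟩

/-- Programs that read a word over `Γ` once, count in unary and prepend tokens to the output. -/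
inductive Prog (Γ : Type)
  | emit (τ : Token)
  | inc (r : Reg)
  | seq (P Q : Prog Γ)
  | loop (r : Reg) (P : Prog Γ)
  | read (P : Γ → Prog Γ)

structure St (Γ : Type) where
  inp : List Γ
  out : List Token
  reg : Reg → ℕ

/-- `Exec P t s s'`: the program `P` leads from `s` to `s'` in `t` steps. -/
inductive Exec {Γ : Type} : Prog Γ → ℕ → St Γ → St Γ → Prop
  | emit (τ i o ρ) : Exec (.emit τ) 1 ⟨i, o, ρ⟩ ⟨i, τ :: o, ρ⟩
  | inc (r i o ρ) : Exec (.inc r) 1 ⟨i, o, ρ⟩ ⟨i, o, Function.update ρ r (ρ r + 1)⟩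
  | seq {P Q t t' s s' s''} : Exec P t s s' → Exec Q t' s' s'' → Exec (.seq P Q) (t' + t) s s''
  | loop_zero {r P i o ρ} : ρ r = 0 → Exec (.loop r P) 1 ⟨i, o, ρ⟩ ⟨i, o, ρ⟩
  | loop_succ {r P i o ρ k t t' s' s''} : ρ r = k + 1 →
      Exec P t ⟨i, o, Function.update ρ r k⟩ s' → Exec (.loop r P) t' s' s'' →
      Exec (.loop r P) (t' + (t + 1)) ⟨i, o, ρ⟩ s''
  | read_nil {P o ρ} : Exec (.read P) 1 ⟨[], o, ρ⟩ ⟨[], o, ρ⟩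
  | read_cons {P a i o ρ t t' s' s''} :
      Exec (P a) t ⟨i, o, ρ⟩ s' → Exec (.read P) t' s' s'' →
      Exec (.read P) (t' + (t + 1)) ⟨a :: i, o, ρ⟩ s''

/-- The stacks of the compiled machine. -/
inductive Stack
  | inp | out | reg (r : Reg)
  deriving DecidableEq, Fintype

def Stack.Sym (Γ : Type) : Stack → Type
  | .inp => Γ
  | .out => Token
  | .reg _ => Unit

def St.stk {Γ : Type} (s : St Γ) : (k : Stack) → List (k.Sym Γ)
  | .inp => s.inp
  | .out => s.out
  | .reg r => List.replicate (s.reg r) ()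

namespace Prog

variable {Γ : Type}

/-- Program points. -/
def Lbl : Prog Γ → Type
  | .emit _ => Unit
  | .inc _ => Unit
  | .seq P Q => P.Lbl ⊕ Q.Lbl
  | .loop _ P => Option P.Lbl
  | .read P => Option (Σ a, (P a).Lbl)

/-- The machine needs finitely many labels; finiteness of `Γ` matters because `read` has a branch
for every symbol. -/
theorem finite_lbl [Finite Γ] : ∀ P : Prog Γ, Finite P.Lbl
  | .emit _ => inferInstanceAs (Finite Unit)
  | .inc _ => inferInstanceAs (Finite Unit)
  | .seq P Q => by
      have := P.finite_lbl; have := Q.finite_lbl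
      exact inferInstanceAs (Finite (P.Lbl ⊕ Q.Lbl))
  | .loop _ P => by
      have := P.finite_lbl
      exact inferInstanceAs (Finite (Option P.Lbl))
  | .read P => by
      have := fun a => (P a).finite_lbl
      exact inferInstanceAs (Finite (Option (Σ a, (P a).Lbl)))

def entry : (P : Prog Γ) → P.Lbl
  | .emit _ => ()
  | .inc _ => ()
  | .seq P _ => Sum.inl P.entry
  | .loop _ _ => none
  | .read _ => none

/-- The statement at a program point, where `emb` places the program points into the labels of the
whole machine and `exit` is the label to continue with. -/
def code {L : Type} : (P : Prog Γ) → (P.Lbl → L) → L → P.Lbl → TM2.Stmt (Stack.Sym Γ) L L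
  -- The next label is stored in the internal state, and `goto id` jumps to it. Hence a single `pop`
  -- can select the branch, and each primitive costs exactly one machine step.
  | .emit τ, _, exit, _ => .push .out (fun _ => τ) (.load (fun _ => exit) (.goto id))
  | .inc r, _, exit, _ => .push (.reg r) (fun _ => ()) (.load (fun _ => exit) (.goto id))
  | .seq P Q, emb, _, .inl l => P.code (fun l => emb (.inl l)) (emb (.inr Q.entry)) l
  | .seq _ Q, emb, exit, .inr l => Q.code (fun l => emb (.inr l)) exit l
  | .loop r P, emb, exit, none =>
      .pop (.reg r) (fun _ o => o.elim exit fun _ => emb (some P.entry)) (.goto id)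
  | .loop _ P, emb, _, some l => P.code (fun l => emb (some l)) (emb none) l
  | .read P, emb, exit, none =>
      .pop .inp (fun _ o => o.elim exit fun a => emb (some ⟨a, (P a).entry⟩)) (.goto id)
  | .read P, emb, _, some ⟨a, l⟩ => (P a).code (fun l => emb (some ⟨a, l⟩)) (emb none) l

end Prog

/-- The configuration at a label; the internal state of the machine repeats the label. -/
def cfg {Γ L : Type} (l : L) (s : St Γ) : TM2.Cfg (Stack.Sym Γ) L L := ⟨some l, l, s.stk⟩

section

variable {Γ : Type} (i : List Γ) (o : List Token) (ρ : Reg → ℕ)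

theorem update_stk_out (o' : List Token) :
    Function.update (St.stk ⟨i, o, ρ⟩) .out o' = St.stk ⟨i, o', ρ⟩ := by
  funext k
  rcases k with _ | _ | _
  · exact Function.update_of_ne (by simp) _ _
  · exact Function.update_self _ _ _
  · exact Function.update_of_ne (by simp) _ _

theorem update_stk_inp (i' : List Γ) :
    Function.update (St.stk ⟨i, o, ρ⟩) .inp i' = St.stk ⟨i', o, ρ⟩ := by
  funext k
  rcases k with _ | _ | _
  · exact Function.update_self _ _ _
  · exact Function.update_of_ne (by simp) _ _
  · exact Function.update_of_ne (by simp) _ _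

theorem update_stk_reg (r : Reg) (n : ℕ) :
    Function.update (St.stk ⟨i, o, ρ⟩) (.reg r) (List.replicate n ()) =
      St.stk ⟨i, o, Function.update ρ r n⟩ := by
  funext k
  rcases k with _ | _ | r'
  · exact Function.update_of_ne (by simp) _ _
  · exact Function.update_of_ne (by simp) _ _
  · by_cases h : r' = r
    · subst h
      exact (Function.update_self _ _ _).trans
        (congrArg (List.replicate · ()) (Function.update_self r' n ρ).symm)
    · exact (Function.update_of_ne (by simpa using h) _ _).trans
        (congrArg (List.replicate · ()) (Function.update_of_ne h n ρ).symm)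

end

theorem flip_bind_step {Γ L : Type} {M : L → TM2.Stmt (Stack.Sym Γ) L L} {l : L}
    {q : TM2.Stmt (Stack.Sym Γ) L L} (h : M l = q) (s : St Γ) :
    flip bind (TM2.step M) (some (cfg l s)) = some (TM2.stepAux q l s.stk) := by
  subst h; rfl

theorem some_cfg_congr {Γ L : Type} {l : L} {S S' : (k : Stack) → List (k.Sym Γ)} (h : S = S') :
    some (⟨some l, l, S⟩ : TM2.Cfg (Stack.Sym Γ) L L) = some ⟨some l, l, S'⟩ := by
  rw [h]

/-- Induction on the execution. The host machine, the placement `emb` and the exit label are all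
arbitrary, so that the induction hypotheses apply to subprograms, whose code sits inside the same
machine with another exit. -/
theorem Exec.sound {Γ : Type} {P : Prog Γ} {t : ℕ} {s s' : St Γ} (h : Exec P t s s') :
    ∀ {L : Type} (M : L → TM2.Stmt (Stack.Sym Γ) L L) (emb : P.Lbl → L) (exit : L),
      (∀ l, M (emb l) = P.code emb exit l) →
      (flip bind (TM2.step M))^[t] (some (cfg (emb P.entry) s)) = some (cfg exit s') := by
  induction h with
  | emit τ i o ρ =>
    intro L M emb exit hM
    exact (flip_bind_step (hM ()) _).trans
      (some_cfg_congr (update_stk_out i o ρ (τ :: o)))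
  | inc r i o ρ =>
    intro L M emb exit hM
    exact (flip_bind_step (hM ()) _).trans
      (some_cfg_congr (update_stk_reg i o ρ r (ρ r + 1)))
  | @seq P Q t t' s s' s'' _ _ ih₁ ih₂ =>
    intro L M emb exit hM
    rw [Function.iterate_add_apply]
    have h₁ := ih₁ M (fun l => emb (.inl l)) (emb (.inr Q.entry)) fun l => hM (.inl l)
    have h₂ := ih₂ M (fun l => emb (.inr l)) exit fun l => hM (.inr l)
    exact (congrArg _ h₁).trans h₂
  | @loop_zero r P i o ρ h =>
    intro L M emb exit hM
    refine (flip_bind_step (hM none) _).trans ?_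
    -- Popping an empty stack leaves it empty, so the failed test of the counter changes only the
    -- label.
    have h₁ : St.stk (Γ := Γ) ⟨i, o, ρ⟩ (.reg r) = List.replicate 0 () :=
      congrArg (List.replicate · ()) h
    have h₂ := update_stk_reg i o ρ r 0
    rw [← h, Function.update_eq_self, h] at h₂
    simp only [Prog.code, TM2.stepAux, h₁, List.replicate_zero]
    exact some_cfg_congr h₂
  | @loop_succ r P i o ρ k t t' s' s'' h _ _ ih₁ ih₂ =>
    intro L M emb exit hM
    have h₀ : flip bind (TM2.step M) (some (cfg (emb none) ⟨i, o, ρ⟩)) =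
        some (cfg (emb (some P.entry)) ⟨i, o, Function.update ρ r k⟩) := by
      refine (flip_bind_step (hM none) _).trans ?_
      have h₁ : St.stk (Γ := Γ) ⟨i, o, ρ⟩ (.reg r) = () :: List.replicate k () :=
        congrArg (List.replicate · ()) h
      simp only [Prog.code, TM2.stepAux, h₁]
      exact some_cfg_congr (update_stk_reg i o ρ r k)
    have h₁ := ih₁ M (fun l => emb (some l)) (emb none) fun l => hM (some l)
    have h₂ := ih₂ M emb exit hM
    rw [Function.iterate_add_apply, Function.iterate_succ_apply]
    exact (congrArg _ ((congrArg _ h₀).trans h₁)).trans h₂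
  | @read_nil P o ρ =>
    intro L M emb exit hM
    exact (flip_bind_step (hM none) _).trans
      (some_cfg_congr (update_stk_inp [] o ρ []))
  | @read_cons P a i o ρ t t' s' s'' _ _ ih₁ ih₂ =>
    intro L M emb exit hM
    have h₀ : flip bind (TM2.step M) (some (cfg (emb none) ⟨a :: i, o, ρ⟩)) =
        some (cfg (emb (some ⟨a, (P a).entry⟩)) ⟨i, o, ρ⟩) :=
      (flip_bind_step (hM none) _).trans
        (some_cfg_congr (update_stk_inp (a :: i) o ρ i))
    have h₁ := ih₁ M (fun l => emb (some ⟨a, l⟩)) (emb none) fun l => hM (some ⟨a, l⟩)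
    have h₂ := ih₂ M emb exit hM
    rw [Function.iterate_add_apply, Function.iterate_succ_apply]
    exact (congrArg _ ((congrArg _ h₀).trans h₁)).trans h₂

/-- The machine that runs `P` and then halts. -/
noncomputable def Prog.machine {Γ : Type} [Fintype Γ] (P : Prog Γ) : FinTM2 :=
  haveI := P.finite_lbl
  haveI : Fintype (Option P.Lbl) := Fintype.ofFinite _
  { K := Stack
    k₀ := .inp
    k₁ := .out
    Γ := Stack.Sym Γ
    Λ := Option P.Lbl
    main := some P.entry
    σ := Option P.Lbl
    initialState := some P.entry
    Γk₀Fin := inferInstanceAs (Fintype Γ)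
    -- At the exit label the internal state is reset, since `haltList` demands the initial one. This
    -- is the extra step in the time bound of `Prog.computable`.
    m := fun l => l.elim (.load (fun _ => some P.entry) .halt) (P.code some none) }

/-- A function computed by a program in polynomial time is computable in polynomial time. -/
theorem Prog.computable {Γ α : Type} [Fintype Γ] (P : Prog Γ) (enc : α → List Token)
    (f : List Γ → α) (time : Polynomial ℕ)
    (h : ∀ w, ∃ t ≤ time.eval w.length,
      Exec P t ⟨w, [], fun _ => 0⟩ ⟨[], enc (f w), fun _ => 0⟩) :
    Nonempty (TM2ComputableInPolyTime (id : List Γ → List Γ) enc f) := by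
  refine ⟨⟨⟨P.machine, Equiv.refl _, Equiv.refl _⟩, time + 1, fun w => Nonempty.some ?_⟩⟩
  obtain ⟨t, ht, hE⟩ := h w
  refine ⟨⟨1 + t, ?_⟩, by simp only [Polynomial.eval_add, Polynomial.eval_one, id]; omega⟩
  rw [Function.iterate_add_apply]
  have hi : initList P.machine (List.map (Equiv.refl Γ).invFun (id w)) =
      cfg (some P.entry) ⟨w, [], fun _ => 0⟩ := by
    refine (TM2.Cfg.mk.injEq _ _ _ _ _ _).mpr ⟨rfl, rfl, ?_⟩
    funext k
    rcases k with _ | _ | _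
    · exact List.map_id w
    · rfl
    · rfl
  have ho : haltList P.machine (List.map (Equiv.refl Token).invFun (enc (f w))) =
      ⟨none, some P.entry, St.stk ⟨[], enc (f w), fun _ => 0⟩⟩ := by
    refine (TM2.Cfg.mk.injEq _ _ _ _ _ _).mpr ⟨rfl, rfl, ?_⟩
    funext k
    rcases k with _ | _ | _
    · rfl
    · exact List.map_id _
    · rfl
  have hs := hE.sound (fun l => Option.elim l (.load (fun _ => some P.entry) .halt)
    (P.code some none)) some none fun l => rfl
  refine (congrArg _ ((congrArg _ (congrArg some hi)).trans hs)).trans ?_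
  exact (congrArg some ho).symm

/-! ## Derived programs -/

/-- `P` leads from `s` to `s'` in at most `B` steps. -/
def Run {Γ : Type} (P : Prog Γ) (B : ℕ) (s s' : St Γ) : Prop := ∃ t ≤ B, Exec P t s s'

namespace Run

variable {Γ : Type} {P Q : Prog Γ} {B B' : ℕ} {s s' s'' : St Γ}

theorem mono (h : Run P B s s') (hB : B ≤ B') : Run P B' s s' :=
  let ⟨t, ht, hE⟩ := h
  ⟨t, ht.trans hB, hE⟩

theorem of_eq {i i' : List Γ} {o o' u u' : List Token} {ρ ρ' ξ ξ' : Reg → ℕ}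
    (h : Run P B ⟨i, o, ρ⟩ ⟨i', o', ρ'⟩) (hB : B ≤ B') (ho : o = u) (ho' : o' = u')
    (hρ : ∀ x, ρ x = ξ x) (hρ' : ∀ x, ρ' x = ξ' x) : Run P B' ⟨i, u, ξ⟩ ⟨i', u', ξ'⟩ := by
  obtain rfl := funext hρ
  obtain rfl := funext hρ'
  subst ho ho'
  exact h.mono hB

theorem seq (h : Run P B s s') (h' : Run Q B' s' s'') : Run (.seq P Q) (B + B') s s'' :=
  let ⟨t, ht, hE⟩ := h
  let ⟨t', ht', hE'⟩ := h'
  ⟨t' + t, by omega, .seq hE hE'⟩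

theorem emit (τ : Token) (i : List Γ) (o ρ) : Run (.emit τ) 1 ⟨i, o, ρ⟩ ⟨i, τ :: o, ρ⟩ :=
  ⟨1, le_rfl, .emit _ _ _ _⟩

theorem inc (r : Reg) (i : List Γ) (o ρ) :
    Run (.inc r) 1 ⟨i, o, ρ⟩ ⟨i, o, Function.update ρ r (ρ r + 1)⟩ :=
  ⟨1, le_rfl, .inc _ _ _ _⟩

/-- The invariant rule: `o k` and `ρ k` describe the state after `k` rounds. The body starts with
`r` already decremented, and `hr` forces it to leave `r` at that value. -/
theorem loop {r : Reg} {i : List Γ} (N : ℕ) (o : ℕ → List Token) (ρ : ℕ → Reg → ℕ)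
    (hr : ∀ k ≤ N, ρ k r = N - k)
    (h : ∀ k < N, Run P B ⟨i, o k, Function.update (ρ k) r (N - (k + 1))⟩
      ⟨i, o (k + 1), ρ (k + 1)⟩) :
    Run (.loop r P) (N * (B + 1) + 1) ⟨i, o 0, ρ 0⟩ ⟨i, o N, ρ N⟩ := by
  induction N generalizing o ρ with
  | zero => exact ⟨1, by omega, .loop_zero (hr 0 le_rfl)⟩
  | succ N ih =>
    obtain ⟨t, ht, hE⟩ := h 0 (by omega)
    obtain ⟨t', ht', hE'⟩ := ih (fun k => o (k + 1)) (fun k => ρ (k + 1))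
      (fun k hk => by rw [hr (k + 1) (by omega)]; omega)
      (fun k hk => by simpa [Nat.add_sub_add_right] using h (k + 1) (by omega))
    refine ⟨t' + (t + 1), ?_, .loop_succ (k := N) (by simpa using hr 0 (by omega)) ?_ hE'⟩
    · rw [Nat.succ_mul]; omega
    · simpa using hE

theorem move {a b : Reg} (hab : a ≠ b) (i : List Γ) (o ρ) :
    Run (.loop a (.inc b)) (2 * ρ a + 1) ⟨i, o, ρ⟩
      ⟨i, o, Function.update (Function.update ρ a 0) b (ρ b + ρ a)⟩ := by
  have := loop (P := .inc b) (B := 1) (r := a) (i := i) (ρ a) (fun _ => o)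
    (fun k => Function.update (Function.update ρ a (ρ a - k)) b (ρ b + k))
    (fun k hk => by simp [hab])
    (fun k hk => (inc b i o _).of_eq le_rfl rfl rfl (fun _ => rfl) (by
      intro x; simp only [Function.update_apply]; grind))
  refine this.of_eq (by omega) rfl rfl ?_ ?_ <;>
    (intro x; simp only [Function.update_apply]; grind)

end Run

namespace Prog

variable {Γ : Type}

/-- No operation, provided that `tmp` is `0`. -/
def skip : Prog Γ := .loop .tmp (.inc .tmp)

def clear (r : Reg) : Prog Γ := .loop r skip

/-- Run `P` with `idx` counting from `0` up to the initial value of `cnt`. -/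
def forLoop (cnt idx : Reg) (P : Prog Γ) : Prog Γ :=
  .seq (.loop cnt (.seq P (.inc idx))) (.loop idx (.inc cnt))

/-- Prepend the value of `r` in unary. -/
def print (r : Reg) : Prog Γ :=
  .seq (.loop r (.seq (.inc .tmp) (.emit (.bit true)))) (.loop .tmp (.inc r))

/-- Prepend an instance of a template made of tokens and unary values of counters. -/
def prints : List (Token ⊕ Reg) → Prog Γ
  | [] => skip
  -- The output is a stack, so the rest of the template is written before its head.
  | .inl τ :: l => .seq (prints l) (.emit τ)
  | .inr r :: l => .seq (prints l) (print r)

/-- Each round adds `len` to the accumulator `aux`; the copy in `tmp` restores `len`, which the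
inner loop consumes. -/
def mulLen (x : Reg) : Prog Γ :=
  .seq (.loop x (.seq (.loop .len (.seq (.inc .aux) (.inc .tmp))) (.loop .tmp (.inc .len))))
    (.loop .aux (.inc x))

def incs (x : Reg) : ℕ → Prog Γ
  | 0 => skip
  | c + 1 => .seq (incs x c) (.inc x)

end Prog

def expand (ρ : Reg → ℕ) : List (Token ⊕ Reg) → List Token
  | [] => []
  | .inl τ :: l => τ :: expand ρ l
  | .inr r :: l => List.replicate (ρ r) (.bit true) ++ expand ρ l

theorem expand_append (ρ : Reg → ℕ) (l l' : List (Token ⊕ Reg)) :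
    expand ρ (l ++ l') = expand ρ l ++ expand ρ l' := by
  induction l with
  | nil => rfl
  | cons a l ih => rcases a with _ | _ <;> simp [expand, ih]

/-! ### Correctness and cost of the derived programs -/

namespace Run

variable {Γ : Type} (i : List Γ) (o : List Token) (ρ : Reg → ℕ)

theorem skip (h : ρ .tmp = 0) : Run Prog.skip 1 ⟨i, o, ρ⟩ ⟨i, o, ρ⟩ :=
  ⟨1, le_rfl, .loop_zero h⟩

theorem clear {r : Reg} (h : ρ .tmp = 0) :
    Run (Prog.clear r) (2 * ρ r + 1) ⟨i, o, ρ⟩ ⟨i, o, Function.update ρ r 0⟩ := by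
  have := loop (P := Prog.skip) (B := 1) (r := r) (i := i) (ρ r) (fun _ => o)
    (fun k => Function.update ρ r (ρ r - k)) (fun k hk => by simp)
    (fun k hk => (skip i o (Function.update ρ r (ρ r - (k + 1)))
        (by simp only [Function.update_apply]; grind)).of_eq le_rfl rfl rfl
      (by intro x; simp only [Function.update_apply]; grind)
      (by intro x; simp only [Function.update_apply]))
  refine this.of_eq (by omega) rfl rfl ?_ ?_ <;>
    (intro x; simp only [Function.update_apply]; grind)

/-- Counting destroys `cnt` but leaves its initial value in `idx`, from which the second loop
restores it. The body must preserve both counters. -/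
theorem forLoop {P : Prog Γ} {B N : ℕ} {cnt idx : Reg} (hne : cnt ≠ idx) (hcnt : ρ cnt = N)
    (hidx : ρ idx = 0) (o : ℕ → List Token)
    (h : ∀ k < N,
      Run P B ⟨i, o k, Function.update (Function.update ρ cnt (N - (k + 1))) idx k⟩
        ⟨i, o (k + 1), Function.update (Function.update ρ cnt (N - (k + 1))) idx k⟩) :
    Run (Prog.forLoop cnt idx P) (N * (B + 4) + 2) ⟨i, o 0, ρ⟩ ⟨i, o N, ρ⟩ := by
  have h₁ := loop (P := .seq P (.inc idx)) (B := B + 1) (r := cnt) (i := i) N o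
    (fun k => Function.update (Function.update ρ cnt (N - k)) idx k)
    (fun k hk => by simp [hne])
    (fun k hk => ((h k hk).seq (inc idx _ _ _)).of_eq le_rfl rfl rfl
      (by intro x; simp only [Function.update_apply]; grind)
      (by intro x; simp only [Function.update_apply]; grind))
  have h₂ := move hne.symm i (o N) (Function.update (Function.update ρ cnt (N - N)) idx N)
  refine (h₁.seq h₂).of_eq ?_ rfl rfl ?_ ?_
  · simp only [Function.update_self]; nlinarith
  all_goals intro x; simp only [Function.update_apply]; grind

theorem print {r : Reg} (hr : r ≠ .tmp) (h : ρ .tmp = 0) :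
    Run (Prog.print r) (5 * ρ r + 2) ⟨i, o, ρ⟩
      ⟨i, List.replicate (ρ r) (.bit true) ++ o, ρ⟩ := by
  have h₁ := loop (P := .seq (.inc .tmp) (.emit (.bit true))) (B := 2) (r := r) (i := i) (ρ r)
    (fun k => List.replicate k (.bit true) ++ o)
    (fun k => Function.update (Function.update ρ r (ρ r - k)) .tmp k)
    (fun k hk => by simp [hr])
    (fun k hk => ((inc .tmp i _ _).seq (emit (.bit true) i _ _)).of_eq le_rfl rfl rfl
      (fun _ => rfl) (by intro x; simp only [Function.update_apply]; grind))
  have h₂ := move hr.symm i (List.replicate (ρ r) (.bit true) ++ o)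
    (Function.update (Function.update ρ r (ρ r - ρ r)) .tmp (ρ r))
  refine (h₁.seq h₂).of_eq ?_ rfl rfl ?_ ?_
  · simp only [Function.update_self]; omega
  all_goals intro x; simp only [Function.update_apply]; grind

theorem prints (l : List (Token ⊕ Reg)) (hl : .inr .tmp ∉ l) (h : ρ .tmp = 0) {M : ℕ}
    (hM : ∀ r, ρ r ≤ M) :
    Run (Prog.prints l) (l.length * (5 * M + 2) + 1) ⟨i, o, ρ⟩ ⟨i, expand ρ l ++ o, ρ⟩ := by
  induction l with
  | nil => exact (skip i o ρ h).mono (by simp)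
  | cons a l ih =>
    have ih := ih fun h => hl (List.mem_cons_of_mem _ h)
    rcases a with τ | r
    · refine (ih.seq (emit τ i _ ρ)).mono ?_
      rw [List.length_cons, Nat.add_mul]; omega
    · have hr : r ≠ .tmp := by rintro rfl; simp at hl
      have := hM r
      rw [expand, List.append_assoc]
      refine (ih.seq (print i _ ρ hr h)).mono ?_
      rw [List.length_cons, Nat.add_mul]; omega

theorem mulLen {x : Reg} (hl : x ≠ .len) (htx : x ≠ .tmp) (hax : x ≠ .aux) (ht : ρ .tmp = 0)
    (ha : ρ .aux = 0) :
    Run (Prog.mulLen x) (ρ x * (7 * ρ .len + 3) + 2) ⟨i, o, ρ⟩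
      ⟨i, o, Function.update ρ x (ρ x * ρ .len)⟩ := by
  have h₀ : ∀ k < ρ x, Run (Γ := Γ)
      (.seq (.loop .len (.seq (.inc .aux) (.inc .tmp))) (.loop .tmp (.inc .len)))
      (5 * ρ .len + 2)
      ⟨i, o, Function.update (Function.update ρ x (ρ x - (k + 1))) .aux (k * ρ .len)⟩
      ⟨i, o, Function.update (Function.update ρ x (ρ x - (k + 1))) .aux ((k + 1) * ρ .len)⟩ := by
    intro k hk
    set ρ' := Function.update (Function.update ρ x (ρ x - (k + 1))) .aux (k * ρ .len) with hρ'
    have h₁ := loop (Γ := Γ) (P := .seq (.inc .aux) (.inc .tmp)) (B := 2) (r := .len) (i := i)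
      (ρ .len) (fun _ => o)
      (fun m => Function.update (Function.update (Function.update ρ' .len (ρ .len - m)) .tmp m)
        .aux (k * ρ .len + m))
      (fun m hm => by simp)
      (fun m hm => ((inc .aux i o _).seq (inc .tmp i o _)).of_eq le_rfl rfl rfl
        (fun _ => rfl) (by intro x; simp only [Function.update_apply]; grind))
    have h₂ := move (Γ := Γ) (a := .tmp) (b := .len) (by simp) i o
      (Function.update (Function.update (Function.update ρ' .len (ρ .len - ρ .len)) .tmp (ρ .len))
        .aux (k * ρ .len + ρ .len))
    refine (h₁.seq h₂).of_eq ?_ rfl rfl ?_ ?_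
    · simp only [Function.update_apply]; grind
    all_goals intro x; simp only [hρ', Function.update_apply]; grind
  have h₁ := loop (Γ := Γ) (r := x) (i := i) (ρ x) (fun _ => o)
    (fun k => Function.update (Function.update ρ x (ρ x - k)) .aux (k * ρ .len))
    (fun k hk => by simp [hax])
    (fun k hk => (h₀ k hk).of_eq le_rfl rfl rfl
      (by intro x; simp only [Function.update_apply]; grind) (fun _ => rfl))
  have h₂ := move hax.symm i o
    (Function.update (Function.update ρ x (ρ x - ρ x)) .aux (ρ x * ρ .len))
  refine (h₁.seq h₂).of_eq ?_ rfl rfl ?_ ?_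
  · simp only [Function.update_self]; nlinarith
  all_goals intro x; simp only [Function.update_apply]; grind

theorem incs (x : Reg) (ht : ρ .tmp = 0) (c : ℕ) :
    Run (Prog.incs x c) (c + 1) ⟨i, o, ρ⟩ ⟨i, o, Function.update ρ x (ρ x + c)⟩ := by
  induction c with
  | zero => simpa [Prog.incs] using skip i o ρ ht
  | succ c ih =>
    refine (ih.seq (inc x _ _ _)).of_eq le_rfl rfl rfl (fun _ => rfl) ?_
    intro x; simp only [Function.update_apply]; grind

end Run

/-- Polynomials can be evaluated in unary. -/
theorem exists_prog_eval {Γ : Type} {x : Reg} (hx : x ≠ .len ∧ x ≠ .tmp ∧ x ≠ .aux)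
    (p : Polynomial ℕ) :
    ∃ (P : Prog Γ) (q : Polynomial ℕ), ∀ i o ρ, ρ x = 0 → ρ .tmp = 0 → ρ .aux = 0 →
      Run P (q.eval (ρ .len)) ⟨i, o, ρ⟩ ⟨i, o, Function.update ρ x (p.eval (ρ .len))⟩ := by
  -- Horner's scheme: adding a constant is repeated increment, and multiplying by the indeterminate
  -- is `mulLen`.
  induction p using Polynomial.recOnHorner with
  | M0 =>
    refine ⟨.skip, 1, fun i o ρ h₀ h₁ h₂ => ?_⟩
    simpa [← h₀] using Run.skip i o ρ h₁
  | MC p a _ _ ih =>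
    obtain ⟨P, q, h⟩ := ih
    refine ⟨.seq P (.incs x a), q + Polynomial.C (a + 1), fun i o ρ h₀ h₁ h₂ => ?_⟩
    have h' := Run.incs i o (Function.update ρ x (p.eval (ρ .len))) x
      (by rw [Function.update_of_ne hx.2.1.symm, h₁]) a
    simpa using (h i o ρ h₀ h₁ h₂).seq h'
  | MX p _ ih =>
    obtain ⟨P, q, h⟩ := ih
    refine ⟨.seq P (.mulLen x), q + (p * (Polynomial.C 7 * Polynomial.X + Polynomial.C 3) +
      Polynomial.C 2), fun i o ρ h₀ h₁ h₂ => ?_⟩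
    have h' := Run.mulLen i o (Function.update ρ x (p.eval (ρ .len))) hx.1 hx.2.1 hx.2.2
      (by rw [Function.update_of_ne hx.2.1.symm, h₁])
      (by rw [Function.update_of_ne hx.2.2.symm, h₂])
    have h'' := (h i o ρ h₀ h₁ h₂).seq h'
    simpa [Function.update_of_ne hx.1.symm, -Polynomial.map_ofNat] using h''

/-! ## Positive formulas over the properties of one node -/

/-- Positive Boolean combinations of `a = c` and `a = b`, where the properties `a`, `b` are
indexed by triples of numbers and the constants `c` by numbers. -/
inductive PForm
  | eqc (κ t j c : ℕ)
  | eqk (κ t j κ' t' j' : ℕ)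
  | and (F G : PForm)
  | or (F G : PForm)

/-- The separators `false` make the triple recoverable, and the unary blocks can be printed from
counters. -/
def propKey (κ t j : ℕ) : Key :=
  ⟨List.replicate κ true ++ false :: (List.replicate t true ++ false :: List.replicate j true)⟩

def constOf (c : ℕ) : Const := ⟨List.replicate c true⟩

def nodeVar : Var := ⟨[]⟩

theorem replicate_append_false_inj : ∀ {m n : ℕ} {x y : List Bool},
    List.replicate m true ++ false :: x = List.replicate n true ++ false :: y → m = n ∧ x = y
  | 0, 0, x, y, h => by simpa using h
  | 0, n + 1, x, y, h => by simp [List.replicate_succ] at h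
  | m + 1, 0, x, y, h => by simp [List.replicate_succ] at h
  | m + 1, n + 1, x, y, h => by
      have := replicate_append_false_inj (m := m) (n := n) (x := x) (y := y)
        (by simpa [List.replicate_succ] using h)
      exact ⟨by omega, this.2⟩

theorem propKey_inj {κ t j κ' t' j' : ℕ} (h : propKey κ t j = propKey κ' t' j') :
    κ = κ' ∧ t = t' ∧ j = j' := by
  obtain ⟨h₁, h₂⟩ := replicate_append_false_inj (Key.mk.inj h)
  obtain ⟨h₂, h₃⟩ := replicate_append_false_inj h₂
  exact ⟨h₁, h₂, by simpa using congrArg List.length h₃⟩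

theorem constOf_injective : Function.Injective constOf := fun m n h => by
  simpa [constOf] using congrArg (fun c => c.name.length) h

namespace PForm

def toCond : PForm → Cond
  | .eqc κ t j c => .eqConst nodeVar (propKey κ t j) (constOf c)
  | .eqk κ t j κ' t' j' => .eqProp nodeVar (propKey κ t j) nodeVar (propKey κ' t' j')
  | .and F G => .and F.toCond G.toCond
  | .or F G => .or F.toCond G.toCond

def Holds (v : ℕ → ℕ → ℕ → Const) : PForm → Prop
  | .eqc κ t j c => v κ t j = constOf c
  | .eqk κ t j κ' t' j' => v κ t j = v κ' t' j'
  | .and F G => F.Holds v ∧ G.Holds v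
  | .or F G => F.Holds v ∨ G.Holds v

def keys : PForm → Finset (ℕ × ℕ × ℕ)
  | .eqc κ t j _ => {(κ, t, j)}
  | .eqk κ t j κ' t' j' => {(κ, t, j), (κ', t', j')}
  | .and F G => F.keys ∪ G.keys
  | .or F G => F.keys ∪ G.keys

def all (l : List PForm) (base : PForm) : PForm := l.foldr .and base

def any (l : List PForm) (base : PForm) : PForm := l.foldr .or base

/-- Without negation or a constant for falsity, a contradiction is obtained by giving one property
two distinct values. It closes disjunctions that have no other base case. -/
def ff : PForm := .and (.eqc 0 0 0 0) (.eqc 0 0 0 1)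

variable {v : ℕ → ℕ → ℕ → Const}

theorem holds_all {l : List PForm} {base : PForm} :
    (all l base).Holds v ↔ (∀ F ∈ l, F.Holds v) ∧ base.Holds v := by
  induction l with
  | nil => simp [all]
  | cons F l ih =>
    rw [all, List.foldr_cons, ← all, Holds, ih]
    simp [and_assoc]

theorem holds_any {l : List PForm} {base : PForm} :
    (any l base).Holds v ↔ (∃ F ∈ l, F.Holds v) ∨ base.Holds v := by
  induction l with
  | nil => simp [any]
  | cons F l ih =>
    rw [any, List.foldr_cons, ← any, Holds, ih]
    simp [or_assoc]

theorem not_holds_ff : ¬ ff.Holds v := fun h => by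
  simpa using constOf_injective (h.1.symm.trans h.2)

/-- The query that asks for a node with the property `F`. -/
def query (ρ : Restrictor) (F : PForm) : Query :=
  .path ρ (.cond (.node ⟨some nodeVar, none⟩) F.toCond)

theorem wellTyped (F : PForm) :
    F.toCond.WellTyped (Descriptor.schema ⟨some nodeVar, none⟩ .node) := by
  have h : ∃ τ, Descriptor.schema ⟨some nodeVar, none⟩ .node nodeVar = some τ ∧ τ.IsSingleton :=
    ⟨.node, by simp [Descriptor.schema], .inl rfl⟩
  induction F with
  | eqc => exact h
  | eqk => exact ⟨h, h⟩
  | and F G ihF ihG => exact ⟨ihF, ihG⟩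
  | or F G ihF ihG => exact ⟨ihF, ihG⟩

theorem isSingleNode_query (ρ : Restrictor) (F : PForm) : (F.query ρ).IsSingleNode ρ :=
  ⟨⟨trivial, F.wellTyped⟩, _, _, rfl⟩

/-- An atom that holds has its properties defined, so the default value for undefined ones is never
consulted by it. Atoms can only become true, which is harmless because the formula is positive. -/
theorem holds_of_holds_toCond {F : PForm} {G : PropertyGraph} {μ : Binding} {n : Obj}
    (hμ : μ nodeVar = some n) (h : F.toCond.Holds G μ) :
    F.Holds fun κ t j => (G.prop n (propKey κ t j)).getD (constOf 0) := by
  induction F with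
  | eqc κ t j c =>
    obtain ⟨o, ho, h⟩ := h
    obtain rfl : n = o := by simpa [hμ] using ho
    simp [Holds, h]
  | eqk κ t j κ' t' j' =>
    obtain ⟨o, o', c, ho, ho', h, h'⟩ := h
    obtain rfl : n = o := by simpa [hμ] using ho
    obtain rfl : n = o' := by simpa [hμ] using ho'
    simp [Holds, h, h']
  | and F G ihF ihG => exact ⟨ihF h.1, ihG h.2⟩
  | or F G ihF ihG => exact h.imp ihF ihG

open Classical in
/-- The graph with one node, whose properties in `S` are given by `v`. -/
noncomputable def graph (S : Finset (ℕ × ℕ × ℕ)) (v : ℕ → ℕ → ℕ → Const) : PropertyGraph where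
  nodes := {0}
  edges := ∅
  disjoint := by simp
  labels _ := ∅
  src := id
  tgt := id
  src_mem := by simp
  tgt_mem := by simp
  -- The chosen triple is the only one with this key, by `propKey_inj`. The set `S` is finite
  -- because a graph has finitely many defined properties.
  prop o a := if h : o = 0 ∧ ∃ x ∈ S, propKey x.1 x.2.1 x.2.2 = a then
    some (v h.2.choose.1 h.2.choose.2.1 h.2.choose.2.2) else none
  prop_mem o a h := by
    by_contra ho
    exact h (dif_neg fun h' => ho (by simp [h'.1]))
  prop_finite := by
    refine (S.finite_toSet.image fun x => ((0 : Obj), propKey x.1 x.2.1 x.2.2)).subset ?_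
    rintro ⟨o, a⟩ h
    by_contra hx
    refine h (dif_neg ?_)
    rintro ⟨rfl, x, hx', rfl⟩
    exact hx ⟨x, hx', rfl⟩

theorem graph_prop {S : Finset (ℕ × ℕ × ℕ)} (v : ℕ → ℕ → ℕ → Const) {κ t j : ℕ}
    (h : (κ, t, j) ∈ S) : (graph S v).prop 0 (propKey κ t j) = some (v κ t j) := by
  have h' : (0 : Obj) = 0 ∧ ∃ x ∈ S, propKey x.1 x.2.1 x.2.2 = propKey κ t j := ⟨rfl, _, h, rfl⟩
  refine (dif_pos h').trans ?_
  obtain ⟨h₁, h₂, h₃⟩ := propKey_inj h'.2.choose_spec.2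
  rw [h₁, h₂, h₃]

/-- The set `S` may exceed the keys of `F`, so that the graph stays fixed when the induction passes
to subformulas. -/
theorem holds_toCond_graph {F : PForm} {S : Finset (ℕ × ℕ × ℕ)} (hS : F.keys ⊆ S) {μ : Binding}
    (hμ : μ nodeVar = some 0) (h : F.Holds v) : F.toCond.Holds (graph S v) μ := by
  induction F with
  | eqc κ t j c =>
    refine ⟨0, hμ, ?_⟩
    rw [graph_prop v (hS (by simp [keys])), h]
  | eqk κ t j κ' t' j' =>
    refine ⟨0, 0, v κ t j, hμ, hμ, graph_prop v (hS (by simp [keys])), ?_⟩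
    rw [graph_prop v (hS (by simp [keys])), show v κ t j = v κ' t' j' from h]
  | and F G ihF ihG =>
    exact ⟨ihF (Finset.union_subset_left hS) h.1, ihG (Finset.union_subset_right hS) h.2⟩
  | or F G ihF ihG =>
    exact h.imp (ihF (Finset.union_subset_left hS)) (ihG (Finset.union_subset_right hS))

theorem satisfiable_query_iff (ρ : Restrictor) (F : PForm) :
    (F.query ρ).Satisfiable ↔ ∃ v, F.Holds v := by
  constructor
  · rintro ⟨G, _, _, ⟨r, hr, rfl⟩, -⟩
    -- Every restrictor only discards matches, whichever it is.
    have hr : r ∈ (Pattern.cond (.node ⟨some nodeVar, none⟩) F.toCond).eval G := by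
      cases ρ <;> exact hr.1
    obtain ⟨⟨n, _, _, rfl⟩, h⟩ := hr
    exact ⟨_, holds_of_holds_toCond (n := n) (by simp [Descriptor.bind]) h⟩
  · rintro ⟨v, h⟩
    have hr : ((⟨0, []⟩, Descriptor.bind ⟨some nodeVar, none⟩ 0) : Path × Binding) ∈
        (Pattern.cond (.node ⟨some nodeVar, none⟩) F.toCond).eval (graph F.keys v) :=
      ⟨⟨0, by simp [graph], by simp [Descriptor.LabelOk], rfl⟩,
        holds_toCond_graph subset_rfl (by simp [Descriptor.bind]) h⟩
    refine ⟨graph F.keys v, _, _,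
      ⟨(⟨0, []⟩, Descriptor.bind ⟨some nodeVar, none⟩ 0), ?_, rfl⟩, rfl⟩
    cases ρ
    · exact ⟨hr, by simp [Path.nodeList]⟩
    · exact ⟨hr, by simp [Path.edgeList]⟩
    · exact ⟨hr, fun _ _ _ _ => Nat.zero_le _⟩

end PForm

/-! ## Templates -/

/-- A word that depends on the values of the counters as instances of a template do. -/
def IsTemplate (F : (Reg → ℕ) → List Token) : Prop :=
  ∃ l : List (Token ⊕ Reg), .inr .tmp ∉ l ∧ ∀ ρ, F ρ = expand ρ l

theorem expand_map_inl (ρ : Reg → ℕ) (l : List Token) : expand ρ (l.map .inl) = l := by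
  induction l with
  | nil => rfl
  | cons τ l ih => simp [expand, ih]

theorem IsTemplate.const (l : List Token) : IsTemplate fun _ => l :=
  ⟨l.map .inl, by simp, fun ρ => (expand_map_inl ρ l).symm⟩

theorem IsTemplate.append {F G : (Reg → ℕ) → List Token} :
    IsTemplate F → IsTemplate G → IsTemplate fun ρ => F ρ ++ G ρ := by
  rintro ⟨l, hl, h⟩ ⟨l', hl', h'⟩
  exact ⟨l ++ l', by simp [hl, hl'], fun ρ => by simp only [expand_append, h, h']⟩

theorem IsTemplate.cons (τ : Token) {F : (Reg → ℕ) → List Token} (h : IsTemplate F) :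
    IsTemplate fun ρ => τ :: F ρ :=
  (const [τ]).append h

/-- Sums of counters and constants. -/
def IsUnary (f : (Reg → ℕ) → ℕ) : Prop :=
  IsTemplate fun ρ => List.replicate (f ρ) (.bit true)

theorem IsUnary.const (c : ℕ) : IsUnary fun _ => c := IsTemplate.const _

theorem IsUnary.reg {r : Reg} (hr : r ≠ .tmp) : IsUnary fun ρ => ρ r :=
  ⟨[.inr r], by simpa using hr.symm, fun ρ => by simp [expand]⟩

theorem IsUnary.add {f g : (Reg → ℕ) → ℕ} (hf : IsUnary f) (hg : IsUnary g) :
    IsUnary fun ρ => f ρ + g ρ := by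
  simpa only [IsUnary, List.replicate_add] using hf.append hg

def Printable (F : (Reg → ℕ) → PForm) : Prop := IsTemplate fun ρ => (F ρ).toCond.encode

theorem encodeBits_propKey (κ t j : ℕ) : encodeBits (propKey κ t j).name =
    List.replicate κ (.bit true) ++ ([.bit false] ++ (List.replicate t (.bit true) ++
      ([.bit false] ++ (List.replicate j (.bit true) ++ [.close])))) := by
  simp [encodeBits, propKey]

theorem isTemplate_propKey {κ t j : (Reg → ℕ) → ℕ} (hκ : IsUnary κ) (ht : IsUnary t)
    (hj : IsUnary j) : IsTemplate fun ρ => encodeBits (propKey (κ ρ) (t ρ) (j ρ)).name := by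
  simp only [encodeBits_propKey]
  exact hκ.append ((IsTemplate.const _).append (ht.append ((IsTemplate.const _).append
    (hj.append (IsTemplate.const _)))))

namespace Printable

theorem eqc {κ t j : (Reg → ℕ) → ℕ} (hκ : IsUnary κ) (ht : IsUnary t)
    (hj : IsUnary j) (c : ℕ) : Printable fun ρ => .eqc (κ ρ) (t ρ) (j ρ) c :=
  (((IsTemplate.const _).append (isTemplate_propKey hκ ht hj)).append (.const _)).cons _

theorem eqk {κ t j κ' t' j' : (Reg → ℕ) → ℕ} (hκ : IsUnary κ) (ht : IsUnary t)
    (hj : IsUnary j) (hκ' : IsUnary κ') (ht' : IsUnary t') (hj' : IsUnary j') :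
    Printable fun ρ => .eqk (κ ρ) (t ρ) (j ρ) (κ' ρ) (t' ρ) (j' ρ) :=
  ((((IsTemplate.const _).append (isTemplate_propKey hκ ht hj)).append (.const _)).append
    (isTemplate_propKey hκ' ht' hj')).cons _

variable {F G : (Reg → ℕ) → PForm}

theorem and (hF : Printable F) (hG : Printable G) : Printable fun ρ => .and (F ρ) (G ρ) :=
  (IsTemplate.append hF hG).cons _

theorem or (hF : Printable F) (hG : Printable G) : Printable fun ρ => .or (F ρ) (G ρ) :=
  (IsTemplate.append hF hG).cons _

/-- The list is fixed and only its entries depend on the counters. Conjunctions whose length depends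
on the input are written by loops instead. -/
theorem all {X : Type} {l : List X} {g : X → (Reg → ℕ) → PForm} (hg : ∀ x ∈ l, Printable (g x))
    (hF : Printable F) : Printable fun ρ => .all (l.map fun x => g x ρ) (F ρ) := by
  induction l with
  | nil => exact hF
  | cons x l ih =>
    exact (hg x List.mem_cons_self).and (ih fun y hy => hg y (List.mem_cons_of_mem _ hy))

theorem any {X : Type} {l : List X} {g : X → (Reg → ℕ) → PForm} (hg : ∀ x ∈ l, Printable (g x))
    (hF : Printable F) : Printable fun ρ => .any (l.map fun x => g x ρ) (F ρ) := by
  induction l with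
  | nil => exact hF
  | cons x l ih =>
    exact (hg x List.mem_cons_self).or (ih fun y hy => hg y (List.mem_cons_of_mem _ hy))

end Printable

/-! ## Tableaux of stack machines -/

/-- Machines with several stacks: in control state `c`, the top symbol of the stack `k c` is
replaced by a word. -/
structure Flow (K C : Type) (Γ : K → Type) where
  k : C → K
  f : (c : C) → Option (Γ (k c)) → C × List (Γ (k c))

namespace Flow

variable {K C : Type} {Γ : K → Type}

/-- On an empty stack `f` receives `none` and the tail is empty, so no case distinction is needed.
-/
def next [DecidableEq K] (M : Flow K C Γ) (x : C × ((k : K) → List (Γ k))) : C × ((k : K) → List (Γ k)) :=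
  ((M.f x.1 (x.2 (M.k x.1)).head?).1, Function.update x.2 (M.k x.1)
    ((M.f x.1 (x.2 (M.k x.1)).head?).2 ++ (x.2 (M.k x.1)).tail))

theorem next_self [DecidableEq K] (M : Flow K C Γ) (x : C × ((k : K) → List (Γ k))) :
    (M.next x).2 (M.k x.1) = (M.f x.1 (x.2 (M.k x.1)).head?).2 ++ (x.2 (M.k x.1)).tail :=
  Function.update_self _ _ _

theorem next_of_ne [DecidableEq K] (M : Flow K C Γ) (x : C × ((k : K) → List (Γ k))) {k : K}
    (h : k ≠ M.k x.1) : (M.next x).2 k = x.2 k :=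
  Function.update_of_ne h _ _

/-- Numberings of the stacks and of finite sets of control states and symbols that are closed
under the transitions of `M`. -/
structure Coding (M : Flow K C Γ) where
  ctrl : Finset C
  sym : Finset (Σ k, Γ k)
  closed : ∀ c ∈ ctrl, ∀ o, (∀ a ∈ o, ⟨M.k c, a⟩ ∈ sym) →
    (M.f c o).1 ∈ ctrl ∧ ∀ a ∈ (M.f c o).2, ⟨M.k c, a⟩ ∈ sym
  ctrlCode : C → ℕ
  ctrlCode_inj : Set.InjOn ctrlCode ctrl
  symCode : (Σ k, Γ k) → ℕ
  symCode_inj : Set.InjOn symCode sym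
  stackCode : K → ℕ
  stackCode_inj : Function.Injective stackCode

/-- The type of control states need not be countable; it will contain all statements of a machine
model. Numberings are therefore injective only on the finite sets that matter. -/
theorem Coding.exists_of_closed [Fintype K] (M : Flow K C Γ) (ctrl : Finset C)
    (sym : Finset (Σ k, Γ k))
    (closed : ∀ c ∈ ctrl, ∀ o, (∀ a ∈ o, ⟨M.k c, a⟩ ∈ sym) →
      (M.f c o).1 ∈ ctrl ∧ ∀ a ∈ (M.f c o).2, ⟨M.k c, a⟩ ∈ sym) :
    ∃ cd : M.Coding, cd.ctrl = ctrl ∧ cd.sym = sym := by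
  obtain ⟨f, hf⟩ := Set.countable_iff_exists_injOn.1 ctrl.countable_toSet
  obtain ⟨g, hg⟩ := Set.countable_iff_exists_injOn.1 sym.countable_toSet
  exact ⟨⟨ctrl, sym, closed, f, hf, g, hg, fun k => Fintype.equivFin K k,
    Fin.val_injective.comp (Fintype.equivFin K).injective⟩, rfl, rfl⟩

variable {M : Flow K C Γ} (cd : M.Coding)

/-! ### Correspondence between valuations and runs -/

namespace Coding

/-- Index of the properties that describe the stack `k`; the index `0` is used for the control
state. -/
def stk (k : K) : ℕ := cd.stackCode k + 1

/-- Code of the content of a cell. -/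
def cell (k : K) (o : Option (Γ k)) : ℕ := o.elim 0 fun a => cd.symCode ⟨k, a⟩ + 1

def Valid (x : C × ((k : K) → List (Γ k))) : Prop :=
  x.1 ∈ cd.ctrl ∧ ∀ k, ∀ a ∈ x.2 k, ⟨k, a⟩ ∈ cd.sym

theorem cell_inj {k : K} {o o' : Option (Γ k)} (ho : ∀ a ∈ o, ⟨k, a⟩ ∈ cd.sym)
    (ho' : ∀ a ∈ o', ⟨k, a⟩ ∈ cd.sym) (h : cd.cell k o = cd.cell k o') : o = o' := by
  rcases o with _ | a <;> rcases o' with _ | b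
  · rfl
  · simp [cell] at h
  · simp [cell] at h
  · have := cd.symCode_inj (ho a rfl) (ho' b rfl) (by simpa [cell] using h)
    simpa using this

variable [DecidableEq K]

variable {cd} in
theorem Valid.next {x : C × ((k : K) → List (Γ k))} (h : cd.Valid x) : cd.Valid (M.next x) := by
  obtain ⟨h₁, h₂⟩ := cd.closed x.1 h.1 (x.2 (M.k x.1)).head?
    fun a ha => h.2 _ a (List.mem_of_mem_head? ha)
  refine ⟨h₁, fun k a ha => ?_⟩
  by_cases hk : k = M.k x.1
  · subst hk
    rw [next_self, List.mem_append] at ha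
    exact ha.elim (h₂ a) fun ha => h.2 _ a (List.mem_of_mem_tail ha)
  · rw [next_of_ne _ _ hk] at ha
    exact h.2 k a ha

theorem valid_iterate {x : C × ((k : K) → List (Γ k))} (hx : cd.Valid x) : ∀ t, cd.Valid (M.next^[t] x)
  | 0 => hx
  | t + 1 => by
    rw [Function.iterate_succ_apply']
    exact (valid_iterate hx t).next

/-- The symbols that may occur on the stack `k`. -/
noncomputable def syms (k : K) : Finset (Γ k) :=
  cd.sym.preimage (Sigma.mk k) sigma_mk_injective.injOn

/-- The transition from the control state `c` and the top symbol `o`, from time `t` to `t + 1`;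
of the words that stay on the stacks it describes only the symbol with index `j`. -/
noncomputable def transition [Fintype K] (c : C) (o : Option (Γ (M.k c))) (t j : ℕ) : PForm :=
  .and (.eqc 0 t 0 (cd.ctrlCode c)) <|
  .and (.eqc (cd.stk (M.k c)) t 0 (cd.cell _ o)) <|
  -- The top symbol is replaced by a word, so the cell at depth `j + 1` moves to depth `j` plus the
  -- length of that word; blank cells below the stack move in the same way.
  .and (.eqk (cd.stk (M.k c)) (t + 1) (j + (M.f c o).2.length) (cd.stk (M.k c)) t (j + 1)) <|
  .all ((List.range (M.f c o).2.length).map fun i =>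
    .eqc (cd.stk (M.k c)) (t + 1) i (cd.cell _ (M.f c o).2[i]?)) <|
  .all ((Finset.univ.erase (M.k c)).toList.map fun k =>
    .eqk (cd.stk k) (t + 1) j (cd.stk k) t j) <|
  .eqc 0 (t + 1) 0 (cd.ctrlCode (M.f c o).1)

/-- Each position `j` chooses a disjunct of its own. The choices agree because every disjunct pins
down the control state and the top symbol at time `t`. -/
noncomputable def step [Fintype K] (t j : ℕ) : PForm :=
  .any (cd.ctrl.toList.map fun c =>
    .any ((cd.syms (M.k c)).toList.map fun a => cd.transition c (some a) t j)
      (cd.transition c none t j)) .ff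

/-- The valuation `v` describes at time `t` the configuration `x`, up to depth `B`. -/
def Row (v : ℕ → ℕ → ℕ → Const) (t B : ℕ) (x : C × ((k : K) → List (Γ k))) : Prop :=
  v 0 t 0 = constOf (cd.ctrlCode x.1) ∧
    ∀ k, ∀ j ≤ B, v (cd.stk k) t j = constOf (cd.cell k (x.2 k)[j]?)

variable [Fintype K] {v : ℕ → ℕ → ℕ → Const} {t j B T : ℕ} {x : C × ((k : K) → List (Γ k))}

theorem holds_step : (cd.step t j).Holds v ↔ ∃ c ∈ cd.ctrl, ∃ o : Option (Γ (M.k c)),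
    (∀ a ∈ o, ⟨M.k c, a⟩ ∈ cd.sym) ∧ (cd.transition c o t j).Holds v := by
  simp only [step, PForm.holds_any, PForm.not_holds_ff, or_false, List.mem_map,
    Finset.mem_toList, exists_exists_and_eq_and, syms, Finset.mem_preimage]
  refine exists_congr fun c => and_congr_right fun _ => ?_
  constructor
  · rintro (⟨a, ha, h⟩ | h)
    · exact ⟨some a, by simpa using ha, h⟩
    · exact ⟨none, by simp, h⟩
  · rintro ⟨_ | a, ha, h⟩
    · exact .inr h
    · exact .inl ⟨a, ha a rfl, h⟩

variable {cd} in
-- The row fixes the codes of the control state and of the top symbol. Codes are injective on valid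
-- data, so the disjunct that holds is the transition the machine really takes.
theorem Row.transition (hx : cd.Valid x) (h : cd.Row v t B x) (hs : (cd.step t j).Holds v) :
    (cd.transition x.1 (x.2 (M.k x.1)).head? t j).Holds v := by
  obtain ⟨c, hc, o, ho, hs⟩ := cd.holds_step.1 hs
  obtain rfl : c = x.1 := cd.ctrlCode_inj hc hx.1 (constOf_injective (hs.1.symm.trans h.1))
  have ho' := cd.cell_inj ho (fun a ha => hx.2 _ a (List.mem_of_mem_head? ha))
    (constOf_injective (hs.2.1.symm.trans
      ((h.2 _ 0 (Nat.zero_le _)).trans (by rw [List.head?_eq_getElem?]))))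
  rwa [← ho']

variable {cd} in
-- One level of depth is lost: after a pop, the cell at depth `B` comes from depth `B + 1`.
theorem Row.succ (hx : cd.Valid x) (h : cd.Row v t (B + 1) x)
    (hs : ∀ j < T, (cd.step t j).Holds v) (hB : B < T) : cd.Row v (t + 1) B (M.next x) := by
  have hs' := fun j hj => Row.transition (j := j) hx h (hs j hj)
  simp only [Coding.transition, PForm.Holds, PForm.holds_all, List.mem_map, List.mem_range,
    Finset.mem_toList, Finset.mem_erase, Finset.mem_univ, and_true, forall_exists_index,
    and_imp, forall_apply_eq_imp_iff₂] at hs'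
  refine ⟨(hs' 0 (by omega)).2.2.2.2.2, fun k j hj => ?_⟩
  by_cases hk : k = M.k x.1
  · subst hk
    rw [next_self]
    obtain hj' | hj' := lt_or_ge j (M.f x.1 (x.2 (M.k x.1)).head?).2.length
    · rw [(hs' 0 (by omega)).2.2.2.1 j hj', List.getElem?_append_left hj']
    · obtain ⟨i, rfl⟩ := Nat.exists_eq_add_of_le' hj'
      rw [(hs' i (by omega)).2.2.1, h.2 _ _ (by omega), List.getElem?_append_right hj',
        Nat.add_sub_cancel, List.getElem?_tail]
  · rw [(hs' j (by omega)).2.2.2.2.1 k hk, h.2 k j (by omega), next_of_ne _ _ hk]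

variable {cd} in
theorem Row.iterate (hx : cd.Valid x) (h : cd.Row v 0 T x)
    (hs : ∀ t < T, ∀ j < T, (cd.step t j).Holds v) :
    ∀ t ≤ T, cd.Valid (M.next^[t] x) ∧ cd.Row v t (T - t) (M.next^[t] x)
  | 0, _ => ⟨hx, h⟩
  | t + 1, ht => by
    obtain ⟨h₁, h₂⟩ := Row.iterate hx h hs t (by omega)
    rw [Function.iterate_succ_apply']
    refine ⟨h₁.next, Row.succ (T := T) h₁ ?_ (hs t ht) (by omega)⟩
    rwa [show T - (t + 1) + 1 = T - t by omega]

open Classical in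
/-- The valuation that describes the run from `x`. -/
noncomputable def run (x : C × ((k : K) → List (Γ k))) (κ t j : ℕ) : Const :=
  if h : ∃ k, cd.stk k = κ then constOf (cd.cell h.choose ((M.next^[t] x).2 h.choose)[j]?)
  else constOf (cd.ctrlCode (M.next^[t] x).1)

theorem row_run (x : C × ((k : K) → List (Γ k))) (t B : ℕ) :
    cd.Row (cd.run x) t B (M.next^[t] x) := by
  refine ⟨dif_neg (by simp [stk]), fun k j _ => ?_⟩
  have h : ∃ k', cd.stk k' = cd.stk k := ⟨k, rfl⟩
  refine (dif_pos h).trans ?_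
  have hk : h.choose = k := cd.stackCode_inj (Nat.succ_injective h.choose_spec)
  rw [hk]

theorem holds_step_run (hx : cd.Valid x) (t j : ℕ) : (cd.step t j).Holds (cd.run x) := by
  have hy := cd.valid_iterate hx t
  have h₀ := fun B => cd.row_run x t B
  have h₁ := fun B => cd.row_run x (t + 1) B
  rw [Function.iterate_succ_apply'] at h₁
  set y := M.next^[t] x
  refine cd.holds_step.2 ⟨y.1, hy.1, (y.2 (M.k y.1)).head?,
    fun a ha => hy.2 _ a (List.mem_of_mem_head? ha), ?_⟩
  simp only [Coding.transition, PForm.Holds, PForm.holds_all, List.mem_map, List.mem_range,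
    Finset.mem_toList, Finset.mem_erase, Finset.mem_univ, and_true, forall_exists_index,
    and_imp, forall_apply_eq_imp_iff₂]
  refine ⟨(h₀ 0).1, ?_, ?_, fun i hi => ?_, fun k hk => ?_, (h₁ 0).1⟩
  · rw [(h₀ 0).2 _ 0 le_rfl, List.head?_eq_getElem?]
  · rw [(h₀ _).2 _ _ le_rfl, (h₁ _).2 _ _ le_rfl, next_self,
      List.getElem?_append_right (Nat.le_add_left _ _), Nat.add_sub_cancel, List.getElem?_tail]
  · rw [(h₁ _).2 _ _ le_rfl, next_self, List.getElem?_append_left hi]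
  · rw [(h₀ _).2 _ _ le_rfl, (h₁ _).2 _ _ le_rfl, next_of_ne _ _ hk]

end Coding

end Flow

/-! ## Turing machines as stack machines -/

section

variable {K Λ σ : Type} {Γ : K → Type}

/-- The stack machine that executes one primitive statement at a time. -/
def flow (k₀ : K) (m : Λ → TM2.Stmt Γ Λ σ) : Flow K (Option (TM2.Stmt Γ Λ σ) × σ) Γ where
  k
    | (some (.push k _ _), _) => k
    | (some (.peek k _ _), _) => k
    | (some (.pop k _ _), _) => k
    -- Statements that touch no stack are made to rewrite the top of `k₀` by itself, via `o.toList`.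
    | _ => k₀
  f
    | (none, v), o => ((none, v), o.toList)
    | (some (.push _ g q), v), o => ((some q, v), g v :: o.toList)
    | (some (.peek _ g q), v), o => ((some q, g v o), o.toList)
    | (some (.pop _ g q), v), o => ((some q, g v o), [])
    | (some (.load g q), v), o => ((some q, g v), o.toList)
    | (some (.branch g q₁ q₂), v), o => ((some (cond (g v) q₁ q₂), v), o.toList)
    | (some (.goto g), v), o => ((some (m (g v)), v), o.toList)
    | (some .halt, v), o => ((none, v), o.toList)

/-- Bounds the number of primitive statements executed in one machine step; for a branch the sum is
a crude bound for the maximum. -/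
def size : TM2.Stmt Γ Λ σ → ℕ
  | .push _ _ q => size q + 1
  | .peek _ _ q => size q + 1
  | .pop _ _ q => size q + 1
  | .load _ q => size q + 1
  | .branch _ q₁ q₂ => size q₁ + size q₂ + 1
  | .goto _ => 1
  | .halt => 1

def ofCfg (m : Λ → TM2.Stmt Γ Λ σ) (c : TM2.Cfg Γ Λ σ) :
    (Option (TM2.Stmt Γ Λ σ) × σ) × ((k : K) → List (Γ k)) :=
  ((c.l.map m, c.var), c.stk)

theorem head?_toList_append_tail {α : Type} (l : List α) : l.head?.toList ++ l.tail = l := by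
  cases l <;> rfl

/-- The symbols that a primitive statement pushes. -/
def pushed : TM2.Stmt Γ Λ σ → Set (Σ k, Γ k)
  | .push k g _ => Set.range fun v => ⟨k, g v⟩
  | _ => ∅

theorem finite_pushed [Finite σ] (q : TM2.Stmt Γ Λ σ) : (pushed q).Finite := by
  cases q <;> simp [pushed, Set.finite_range]

/-- Control states and symbols can be coded, and a given finite set of symbols can be
included. -/
theorem exists_coding [Fintype K] [Fintype Λ] [Fintype σ] (k₀ : K) (m : Λ → TM2.Stmt Γ Λ σ)
    (A : Set (Σ k, Γ k)) (hA : A.Finite) :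
    ∃ cd : (flow k₀ m).Coding, (∀ l v, (some (m l), v) ∈ cd.ctrl) ∧ ∀ a ∈ A, a ∈ cd.sym := by
  classical
  set Q : Finset (TM2.Stmt Γ Λ σ) := Finset.univ.biUnion fun l => TM2.stmts₁ (m l) with hQ
  have hm : ∀ l, m l ∈ Q := fun l =>
    Finset.mem_biUnion.2 ⟨l, Finset.mem_univ l, TM2.stmts₁_self⟩
  have hsub : ∀ q ∈ Q, ∀ q' ∈ TM2.stmts₁ q, q' ∈ Q := fun q hq q' hq' => by
    obtain ⟨l, hl, hq⟩ := Finset.mem_biUnion.1 hq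
    exact Finset.mem_biUnion.2 ⟨l, hl, TM2.stmts₁_trans hq hq'⟩
  have hfin : (A ∪ ⋃ q ∈ Q, pushed q).Finite :=
    hA.union (Q.finite_toSet.biUnion fun q _ => finite_pushed q)
  obtain ⟨cd, hctrl, hsym⟩ := Flow.Coding.exists_of_closed (flow k₀ m)
    -- Control states are the substatements of the machine's statements together with `none` for the
    -- halted machine. New symbols arise only from pushes, whose values range over the finite
    -- internal state.
    (Finset.insertNone Q ×ˢ Finset.univ) hfin.toFinset (by
      rintro ⟨_ | q, v⟩ hc o ho
      · refine ⟨by simp [flow], fun a ha => ho a (Option.mem_toList.1 ha)⟩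
      · have hq : q ∈ Q := by simpa using hc
        have hs := hsub q hq
        cases q with
        | push k g q =>
          refine ⟨by simpa [flow] using hs q (by simp [TM2.stmts₁, TM2.stmts₁_self]),
            fun a ha => ?_⟩
          rcases List.mem_cons.1 ha with rfl | ha
          · simp only [Set.Finite.mem_toFinset]
            exact .inr (Set.mem_biUnion hq ⟨v, rfl⟩)
          · exact ho a (Option.mem_toList.1 ha)
        | peek k g q =>
          exact ⟨by simpa [flow] using hs q (by simp [TM2.stmts₁, TM2.stmts₁_self]),
            fun a ha => ho a (Option.mem_toList.1 ha)⟩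
        | pop k g q =>
          exact ⟨by simpa [flow] using hs q (by simp [TM2.stmts₁, TM2.stmts₁_self]),
            fun a ha => absurd ha List.not_mem_nil⟩
        | load g q =>
          exact ⟨by simpa [flow] using hs q (by simp [TM2.stmts₁, TM2.stmts₁_self]),
            fun a ha => ho a (Option.mem_toList.1 ha)⟩
        | branch g q₁ q₂ =>
          refine ⟨?_, fun a ha => ho a (Option.mem_toList.1 ha)⟩
          have h₁ := hs q₁ (by simp [TM2.stmts₁, TM2.stmts₁_self])
          have h₂ := hs q₂ (by simp [TM2.stmts₁, TM2.stmts₁_self])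
          cases hg : g v <;> simpa [flow, hg]
        | goto g =>
          exact ⟨by simpa [flow] using hm (g v), fun a ha => ho a (Option.mem_toList.1 ha)⟩
        | halt =>
          exact ⟨by simp [flow], fun a ha => ho a (Option.mem_toList.1 ha)⟩)
  refine ⟨cd, fun l v => ?_, fun a ha => ?_⟩
  · rw [hctrl]; simpa using hm l
  · rw [hsym]; simp [ha]

variable [DecidableEq K] (k₀ : K) (m : Λ → TM2.Stmt Γ Λ σ)

theorem update_head?_toList (S : (k : K) → List (Γ k)) (k : K) :
    Function.update S k ((S k).head?.toList ++ (S k).tail) = S := by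
  rw [head?_toList_append_tail, Function.update_eq_self]

theorem next_halted (v : σ) (S : (k : K) → List (Γ k)) :
    (flow k₀ m).next ((none, v), S) = ((none, v), S) :=
  congrArg (Prod.mk _) (update_head?_toList S k₀)

/-- After a `goto` the control state is the statement at the target label, which is how `ofCfg`
represents a configuration; so the simulation is exact at step boundaries. -/
theorem iterate_next_stepAux (q : TM2.Stmt Γ Λ σ) : ∀ (v : σ) (S : (k : K) → List (Γ k)),
    ∃ n ≤ size q, (flow k₀ m).next^[n] ((some q, v), S) = ofCfg m (TM2.stepAux q v S) := by
  induction q with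
  | push k g q ih =>
    intro v S
    obtain ⟨n, hn, h⟩ := ih v (Function.update S k (g v :: S k))
    refine ⟨n + 1, Nat.succ_le_succ hn, (congrArg ((flow k₀ m).next^[n]) ?_).trans h⟩
    exact congrArg (fun l => ((some q, v), Function.update S k (g v :: l)))
      (head?_toList_append_tail (S k))
  | peek k g q ih =>
    intro v S
    obtain ⟨n, hn, h⟩ := ih (g v (S k).head?) S
    exact ⟨n + 1, Nat.succ_le_succ hn,
      (congrArg _ (congrArg (Prod.mk _) (update_head?_toList S k))).trans h⟩
  | pop k g q ih =>
    intro v S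
    obtain ⟨n, hn, h⟩ := ih (g v (S k).head?) (Function.update S k (S k).tail)
    exact ⟨n + 1, Nat.succ_le_succ hn, h⟩
  | load g q ih =>
    intro v S
    obtain ⟨n, hn, h⟩ := ih (g v) S
    exact ⟨n + 1, Nat.succ_le_succ hn,
      (congrArg _ (congrArg (Prod.mk _) (update_head?_toList S k₀))).trans h⟩
  | branch g q₁ q₂ ih₁ ih₂ =>
    intro v S
    have h₀ : (flow k₀ m).next ((some (.branch g q₁ q₂), v), S) =
        ((some (cond (g v) q₁ q₂), v), S) := congrArg (Prod.mk _) (update_head?_toList S k₀)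
    cases hg : g v
    · obtain ⟨n, hn, h⟩ := ih₂ v S
      refine ⟨n + 1, by simp only [size]; omega, ?_⟩
      rw [Function.iterate_succ_apply, h₀, TM2.stepAux, hg]
      exact h
    · obtain ⟨n, hn, h⟩ := ih₁ v S
      refine ⟨n + 1, by simp only [size]; omega, ?_⟩
      rw [Function.iterate_succ_apply, h₀, TM2.stepAux, hg]
      exact h
  | goto g =>
    intro v S
    exact ⟨1, le_rfl, congrArg (Prod.mk _) (update_head?_toList S k₀)⟩
  | halt =>
    intro v S
    exact ⟨1, le_rfl, congrArg (Prod.mk _) (update_head?_toList S k₀)⟩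

theorem iterate_none {α : Type} (f : α → Option α) :
    ∀ s, (flip bind f)^[s] none = none
  | 0 => rfl
  | s + 1 => iterate_none f s

theorem iterate_next_of_step {D : ℕ} (hD : ∀ l, size (m l) ≤ D) :
    ∀ (s : ℕ) (a b : TM2.Cfg Γ Λ σ), (flip bind (TM2.step m))^[s] (some a) = some b →
      ∃ n ≤ s * D, (flow k₀ m).next^[n] (ofCfg m a) = ofCfg m b
  | 0, a, b, h => ⟨0, by simp, by rw [Option.some.inj h]; rfl⟩
  | s + 1, ⟨none, v, S⟩, b, h => by
    rw [Function.iterate_succ_apply] at h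
    exact absurd ((iterate_none (TM2.step m) s).symm.trans h) (by simp)
  | s + 1, ⟨some l, v, S⟩, b, h => by
    obtain ⟨n, hn, h₁⟩ := iterate_next_stepAux k₀ m (m l) v S
    obtain ⟨n', hn', h₂⟩ := iterate_next_of_step hD s (TM2.stepAux (m l) v S) b h
    refine ⟨n' + n, ?_, ?_⟩
    · have := hD l
      rw [Nat.succ_mul]
      omega
    · rw [Function.iterate_add_apply]
      exact (congrArg _ h₁).trans h₂

/-- If `a` reaches the halting configuration `b` in `s` steps, then the stack machine is at `b`
at all later times. -/
theorem iterate_next_of_halts {D : ℕ} (hD : ∀ l, size (m l) ≤ D) {s T : ℕ}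
    {a b : TM2.Cfg Γ Λ σ} (h : (flip bind (TM2.step m))^[s] (some a) = some b) (hb : b.l = none)
    (hT : s * D ≤ T) : (flow k₀ m).next^[T] (ofCfg m a) = ofCfg m b := by
  obtain ⟨n, hn, h⟩ := iterate_next_of_step k₀ m hD s a b h
  obtain ⟨d, rfl⟩ := Nat.exists_eq_add_of_le' (hn.trans hT)
  rw [Function.iterate_add_apply, h]
  obtain ⟨l, v, S⟩ := b
  obtain rfl : l = none := hb
  exact Function.iterate_fixed (next_halted k₀ m v S) d

end

/-! ## The formula of a verifier -/

namespace PForm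

/-- Conjunction of `F 0, …, F (N - 1)` and `G`. -/
def conj (N : ℕ) (F : ℕ → PForm) (G : PForm) : PForm := N.rec G fun i A => .and (F i) A

/-- Conjunction of the `F t j` with `t, j < N`, and `G`. -/
def conj₂ (N : ℕ) (F : ℕ → ℕ → PForm) (G : PForm) : ℕ → PForm :=
  fun T => T.rec G fun t A => conj N (F t) A

/-- Conjunction of the `F a (n + j)`, where `a` is the symbol of `w` with index `j`, and `G`. -/
def conjWord {Γ : Type} (F : Γ → ℕ → PForm) : List Γ → ℕ → PForm → PForm
  | [], _, G => G
  | a :: w, n, G => conjWord F w (n + 1) (.and (F a n) G)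

variable {v : ℕ → ℕ → ℕ → Const}

theorem holds_conj {N : ℕ} {F : ℕ → PForm} {G : PForm} :
    (conj N F G).Holds v ↔ (∀ i < N, (F i).Holds v) ∧ G.Holds v := by
  induction N with
  | zero => simp [conj]
  | succ N ih =>
    rw [conj, Holds, ← conj, ih, Nat.forall_lt_succ_right]
    tauto

theorem holds_conj₂ {N T : ℕ} {F : ℕ → ℕ → PForm} {G : PForm} :
    (conj₂ N F G T).Holds v ↔ (∀ t < T, ∀ j < N, (F t j).Holds v) ∧ G.Holds v := by
  induction T with
  | zero => simp [conj₂]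
  | succ T ih =>
    rw [conj₂, holds_conj, ← conj₂, ih, Nat.forall_lt_succ_right]
    tauto

theorem holds_conjWord {Γ : Type} {F : Γ → ℕ → PForm} {w : List Γ} {n : ℕ} {G : PForm} :
    (conjWord F w n G).Holds v ↔
      (∀ j a, w[j]? = some a → (F a (n + j)).Holds v) ∧ G.Holds v := by
  induction w generalizing n G with
  | nil => simp [conjWord]
  | cons a w ih =>
    rw [conjWord, ih, Holds]
    constructor
    · rintro ⟨h₁, h₂, h₃⟩
      refine ⟨fun j b hb => ?_, h₃⟩
      cases j with
      | zero => obtain rfl : a = b := by simpa using hb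
                exact h₂
      | succ j => rw [← add_assoc, add_right_comm]; exact h₁ j b (by simpa using hb)
    · rintro ⟨h₁, h₂⟩
      refine ⟨fun j b hb => ?_, h₁ 0 a rfl, h₂⟩
      rw [add_right_comm, add_assoc]; exact h₁ (j + 1) b (by simpa using hb)

end PForm

/-- A machine that accepts by writing `acc` on top of the stack `k₁`. -/
structure Verifier (Γ K Λ σ : Type) (S : K → Type) where
  k₀ : K
  k₁ : K
  m : Λ → TM2.Stmt S Λ σ
  main : Λ
  init : σ
  inSym : Γ ⊕ Bool → S k₀
  inSym_inj : Function.Injective inSym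
  acc : S k₁
  cd : (flow k₀ m).Coding
  main_mem : (some (m main), init) ∈ cd.ctrl
  inSym_mem : ∀ s, ⟨k₀, inSym s⟩ ∈ cd.sym
  acc_mem : ⟨k₁, acc⟩ ∈ cd.sym

/-- Here `p i o` reads as "cell `i` contains `o`". A blank forces the next cell to be blank, so the
bits form an initial segment, and the blank at `P` bounds its length. -/
theorem exists_certificate {P : ℕ} : ∀ {T : ℕ} {p : ℕ → Option Bool → Prop},
    (∀ i ≤ T, (∃ b, p i (some b)) ∨ p i none ∧ p (i + 1) none) →
    (∀ i o o', p i o → p i o' → o = o') → p P none → P ≤ T →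
    ∃ y : List Bool, y.length ≤ P ∧ ∀ i ≤ T, p i y[i]? := by
  have key : ∀ {T : ℕ} {p : ℕ → Option Bool → Prop},
      (∀ i ≤ T, (∃ b, p i (some b)) ∨ p i none ∧ p (i + 1) none) →
      (∀ i o o', p i o → p i o' → o = o') → p 0 none → ∀ i ≤ T, p i none := by
    intro T p h hp h₀ i hi
    induction i with
    | zero => exact h₀
    | succ i ih =>
      have := ih (by omega)
      rcases h i (by omega) with ⟨b, hb⟩ | hb
      · exact absurd (hp i _ _ hb this) (by simp)
      · exact hb.2
  induction P with
  | zero =>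
    intro T p h hp h₀ _
    exact ⟨[], le_rfl, fun i hi => by simpa using key h hp h₀ i hi⟩
  | succ P ih =>
    intro T p h hp h₀ hT
    rcases h 0 (Nat.zero_le _) with ⟨b, hb⟩ | hb
    · obtain ⟨T, rfl⟩ := Nat.exists_eq_add_of_le' (Nat.one_le_of_lt hT)
      obtain ⟨y, hy, hy'⟩ := ih (T := T) (p := fun i => p (i + 1)) (fun i hi => h _ (by omega))
        (fun i => hp _) h₀ (by omega)
      refine ⟨b :: y, by simpa using hy, fun i hi => ?_⟩
      cases i with
      | zero => exact hb
      | succ i => simpa using hy' i (by omega)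
    · exact ⟨[], by simp, fun i hi => by simpa using key h hp hb.1 i hi⟩

namespace Verifier

variable {Γ K Λ σ : Type} {S : K → Type} (V : Verifier Γ K Λ σ S)

def startF : PForm := .eqc 0 0 0 (V.cd.ctrlCode (some (V.m V.main), V.init))

def inputF (a : Γ) (n : ℕ) : PForm :=
  .eqc (V.cd.stk V.k₀) 0 n (V.cd.cell V.k₀ (some (V.inSym (.inl a))))

def endF (n P : ℕ) : PForm := .eqc (V.cd.stk V.k₀) 0 (n + P) (V.cd.cell V.k₀ none)

def acceptF (T : ℕ) : PForm := .eqc (V.cd.stk V.k₁) T 0 (V.cd.cell V.k₁ (some V.acc))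

open Classical in
/-- The certificate is a word over `Bool`, and the stacks other than `k₀` are empty at first. -/
noncomputable def initF [Fintype K] (n i : ℕ) : PForm :=
  .and
    (.any ([true, false].map fun b =>
      .eqc (V.cd.stk V.k₀) 0 (n + i) (V.cd.cell V.k₀ (some (V.inSym (.inr b)))))
      (.and (.eqc (V.cd.stk V.k₀) 0 (n + i) (V.cd.cell V.k₀ none))
        (.eqc (V.cd.stk V.k₀) 0 (n + (i + 1)) (V.cd.cell V.k₀ none))))
    -- `startF` is repeated here merely as the base that a conjunction needs.
    (.all ((Finset.univ.erase V.k₀).toList.map fun k =>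
      .eqc (V.cd.stk k) 0 i (V.cd.cell k none)) V.startF)

variable [DecidableEq K]

/-- The initial configuration on the word `w` and the certificate `y`. -/
def start (w : List Γ) (y : List Bool) :
    (Option (TM2.Stmt S Λ σ) × σ) × ((k : K) → List (S k)) :=
  ((some (V.m V.main), V.init),
    Function.update (fun _ => []) V.k₀ ((w.map Sum.inl ++ y.map Sum.inr).map V.inSym))

theorem valid_start (w : List Γ) (y : List Bool) : V.cd.Valid (V.start w y) := by
  refine ⟨V.main_mem, fun k a ha => ?_⟩
  by_cases hk : k = V.k₀
  · subst hk
    simp only [start, Function.update_self] at ha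
    obtain ⟨s, _, rfl⟩ := List.mem_map.1 ha
    exact V.inSym_mem s
  · simp [start, hk] at ha

variable [Fintype K]

/-- There is a certificate of length at most `P` that is accepted in time `T`. -/
noncomputable def formula (w : List Γ) (P T : ℕ) : PForm :=
  -- The initial row is needed at all depths up to and including `T`, hence `T + 1` conjuncts; the
  -- step formulas need only `t, j < T`.
  .conj (T + 1) (V.initF w.length) <|
  .conj₂ T V.cd.step (.and (V.acceptF T) (.and (V.endF w.length P)
    (.conjWord V.inputF w 0 V.startF))) T

/-- From a valuation, the certificate is read off the cells after the input, and the initial row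
then determines the top of `k₁` at time `T`. Conversely the valuation `run` of an accepting
computation satisfies every conjunct. -/
theorem holds_formula_iff (w : List Γ) {P T : ℕ} (hP : P ≤ T) :
    (∃ v, (V.formula w P T).Holds v) ↔ ∃ y : List Bool, y.length ≤ P ∧
      (((flow V.k₀ V.m).next^[T] (V.start w y)).2 V.k₁).head? = some V.acc := by
  simp only [formula, PForm.holds_conj, PForm.holds_conj₂, PForm.holds_conjWord, PForm.Holds,
    initF, PForm.holds_any, PForm.holds_all, List.mem_map, Finset.mem_toList, Finset.mem_erase,
    Finset.mem_univ, and_true, forall_exists_index, and_imp, forall_apply_eq_imp_iff₂, startF,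
    endF, acceptF, inputF, exists_exists_and_eq_and, zero_add, Nat.lt_succ_iff]
  constructor
  · rintro ⟨v, hinit, hstep, hacc, hend, hinp, hstart⟩
    obtain ⟨y, hy, hy'⟩ := exists_certificate (P := P) (T := T)
      (p := fun i o => v (V.cd.stk V.k₀) 0 (w.length + i) =
        constOf (V.cd.cell V.k₀ (o.map fun b => V.inSym (.inr b))))
      (fun i hi => by
        rcases (hinit i hi).1 with ⟨b, _, hb⟩ | hb
        · exact .inl ⟨b, hb⟩
        · exact .inr hb)
      (fun i o o' h h' => by
        have := V.cd.cell_inj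
          (fun a ha => by obtain ⟨b, _, rfl⟩ := Option.map_eq_some_iff.1 ha; exact V.inSym_mem _)
          (fun a ha => by obtain ⟨b, _, rfl⟩ := Option.map_eq_some_iff.1 ha; exact V.inSym_mem _)
          (constOf_injective (h.symm.trans h'))
        exact Option.map_injective
          (fun b b' h => Sum.inr_injective (V.inSym_inj h)) this)
      hend hP
    refine ⟨y, hy, ?_⟩
    have hrow : V.cd.Row v 0 T (V.start w y) := by
      refine ⟨hstart, fun k j hj => ?_⟩
      by_cases hk : k = V.k₀
      · subst hk
        simp only [start, Function.update_self, List.getElem?_map]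
        obtain hj' | hj' := lt_or_ge j w.length
        · rw [List.getElem?_append_left (by simpa using hj'),
            hinp j w[j] (List.getElem?_eq_getElem hj')]
          simp [hj']
        · obtain ⟨i, rfl⟩ := Nat.exists_eq_add_of_le hj'
          rw [List.getElem?_append_right (by simp), hy' i (by omega)]
          simp [Option.map_map, Function.comp_def]
      · rw [(hinit j hj).2.1 k hk]
        simp [start, hk]
    obtain ⟨hv, hr⟩ := hrow.iterate (V.valid_start w y) hstep T le_rfl
    rw [List.head?_eq_getElem?]
    refine V.cd.cell_inj (fun a ha => hv.2 _ a (List.mem_of_getElem? ha)) ?_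
      (constOf_injective ((hr.2 V.k₁ 0 (Nat.zero_le _)).symm.trans hacc))
    rintro _ ⟨⟩
    exact V.acc_mem
  · rintro ⟨y, hy, h⟩
    have hrow := fun t B => V.cd.row_run (V.start w y) t B
    have hk₀ : ∀ j, V.cd.run (V.start w y) (V.cd.stk V.k₀) 0 j =
        constOf (V.cd.cell V.k₀ ((w.map Sum.inl ++ y.map Sum.inr)[j]?.map V.inSym)) := fun j => by
      rw [(hrow 0 j).2 V.k₀ j le_rfl]
      simp only [start, Function.iterate_zero, id_eq, Function.update_self, List.getElem?_map]
    have hk : ∀ k ≠ V.k₀, ∀ j, V.cd.run (V.start w y) (V.cd.stk k) 0 j =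
        constOf (V.cd.cell k none) := fun k hk j => by
      rw [(hrow 0 j).2 k j le_rfl]
      simp [start, hk]
    refine ⟨V.cd.run (V.start w y), fun i hi => ⟨?_, fun k hk' => hk k hk' i, (hrow 0 0).1⟩,
      fun t _ j _ => V.cd.holds_step_run (V.valid_start w y) t j, ?_, ?_, fun j a ha => ?_,
      (hrow 0 0).1⟩
    · rw [hk₀, hk₀, List.getElem?_append_right (by simp), List.getElem?_append_right (by simp)]
      obtain hi' | hi' := lt_or_ge i y.length
      · exact .inl ⟨y[i], by simp, by simp [hi']⟩
      -- Past the end of `y`, this cell and the next are both blank.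
      · refine .inr ⟨?_, ?_⟩ <;> congr 2 <;> simp <;> omega
    · rw [(hrow T 0).2 V.k₁ 0 le_rfl, ← List.head?_eq_getElem?, h]
    · rw [hk₀, List.getElem?_append_right (by simp)]
      congr 2
      simpa using hy
    · rw [hk₀, List.getElem?_append_left (by simpa using (List.getElem?_eq_some_iff.1 ha).1)]
      simp [ha]

end Verifier

/-! ## The program that writes the formula -/

/-- Functions bounded by a polynomial. -/
def PolyBounded (f : ℕ → ℕ) : Prop := ∃ q : Polynomial ℕ, ∀ n, f n ≤ q.eval n

namespace PolyBounded

variable {f g : ℕ → ℕ}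

theorem const (c : ℕ) : PolyBounded fun _ => c := ⟨.C c, fun n => by simp⟩

theorem id : PolyBounded fun n => n := ⟨.X, fun n => by simp⟩

theorem eval (p : Polynomial ℕ) : PolyBounded fun n => p.eval n := ⟨p, fun _ => le_rfl⟩

theorem add : PolyBounded f → PolyBounded g → PolyBounded fun n => f n + g n := by
  rintro ⟨p, hp⟩ ⟨q, hq⟩
  exact ⟨p + q, fun n => by simpa using Nat.add_le_add (hp n) (hq n)⟩

theorem mul : PolyBounded f → PolyBounded g → PolyBounded fun n => f n * g n := by
  rintro ⟨p, hp⟩ ⟨q, hq⟩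
  exact ⟨p * q, fun n => by simpa using Nat.mul_le_mul (hp n) (hq n)⟩

end PolyBounded

/-- The constant depends on the template alone, not on the counters; this uniformity makes loops
around the program polynomial. -/
theorem exists_print {F : (Reg → ℕ) → List Token} (hF : IsTemplate F) (Γ : Type) :
    ∃ (P : Prog Γ) (c : ℕ), ∀ i o ρ M, ρ .tmp = 0 → (∀ r, ρ r ≤ M) →
      Run P (c * (M + 1)) ⟨i, o, ρ⟩ ⟨i, F ρ ++ o, ρ⟩ := by
  obtain ⟨l, hl, h⟩ := hF
  refine ⟨.prints l, 5 * l.length + 1, fun i o ρ M h₀ hM => ?_⟩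
  rw [h]
  exact (Run.prints i o ρ l hl h₀ hM).mono (by nlinarith)

/-- A printable formula can be added to the conjunction that has been written so far. -/
theorem exists_add {F : (Reg → ℕ) → PForm} (hF : Printable F) (Γ : Type) :
    ∃ (P : Prog Γ) (c : ℕ), ∀ i A ρ M, ρ .tmp = 0 → (∀ r, ρ r ≤ M) →
      Run P (c * (M + 1)) ⟨i, A.toCond.encode, ρ⟩ ⟨i, (PForm.and (F ρ) A).toCond.encode, ρ⟩ := by
  obtain ⟨P, c, h⟩ := exists_print (hF.cons .and) Γ
  exact ⟨P, c, fun i A ρ M h₀ hM => h i _ ρ M h₀ hM⟩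

theorem Run.readWord {Γ : Type} {P : Γ → Prog Γ} {B M : ℕ} {F : Γ → ℕ → PForm}
    {ρ : ℕ → Reg → ℕ}
    (h : ∀ a i n A, n < M → Run (P a) B ⟨i, A.toCond.encode, ρ n⟩
      ⟨i, (PForm.and (F a n) A).toCond.encode, ρ (n + 1)⟩) :
    ∀ (w : List Γ) (n : ℕ) (A : PForm), n + w.length ≤ M →
      Run (.read P) (w.length * (B + 1) + 1) ⟨w, A.toCond.encode, ρ n⟩
        ⟨[], (PForm.conjWord F w n A).toCond.encode, ρ (n + w.length)⟩
  | [], _, _, _ => ⟨1, by simp, .read_nil⟩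
  | a :: w, n, A, hn => by
    rw [List.length_cons] at hn
    obtain ⟨t, ht, hE⟩ := h a w n A (by omega)
    obtain ⟨t', ht', hE'⟩ := readWord h w (n + 1) (.and (F a n) A) (by omega)
    refine ⟨t' + (t + 1), by rw [List.length_cons, Nat.succ_mul]; omega, .read_cons hE ?_⟩
    rwa [List.length_cons, ← add_assoc, add_right_comm]

/-- Counters between the phases of the program. -/
def regs (n p t w : ℕ) : Reg → ℕ
  | .len => n
  | .cert => p
  | .time => t
  | .width => w
  | _ => 0

/-- `len` counts the symbols already read, so it serves as the index of the current symbol and ends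
as the input length. The sum of the constants over the finite alphabet bounds each branch uniformly.
-/
theorem exists_addWord {Γ : Type} [Fintype Γ] {F : Γ → ℕ → PForm}
    (hF : ∀ a, Printable fun ρ => F a (ρ .len)) :
    ∃ (P : Prog Γ) (c : ℕ), ∀ w A,
      Run P (w.length * (c * (w.length + 1) + 2) + 1) ⟨w, A.toCond.encode, regs 0 0 0 0⟩
        ⟨[], (PForm.conjWord F w 0 A).toCond.encode, regs w.length 0 0 0⟩ := by
  choose P c h using fun a => exists_add (hF a) Γ
  refine ⟨.read fun a => .seq (P a) (.inc .len), ∑ a, c a, fun w A => ?_⟩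
  have := Run.readWord (P := fun a => .seq (P a) (.inc .len))
    (B := (∑ a, c a) * (w.length + 1) + 1) (M := w.length) (F := F) (ρ := fun n => regs n 0 0 0)
    (fun a i n A hn => by
      refine ((h a i A (regs n 0 0 0) w.length rfl ?_).seq (Run.inc .len i _ _)).of_eq ?_ rfl rfl
        (fun _ => rfl) ?_
      · intro r; cases r <;> simp [regs]; omega
      · have := Finset.single_le_sum (f := c) (fun _ _ => Nat.zero_le _) (Finset.mem_univ a)
        gcongr
      · intro r; cases r <;> simp [regs]) w 0 A (by simp)
  simpa using this

theorem exists_conj {Γ : Type} {F : ℕ → ℕ → PForm}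
    (hF : Printable fun ρ => F (ρ .len) (ρ .row)) :
    ∃ (P : Prog Γ) (c : ℕ), ∀ i A n p t w M, n ≤ M → p ≤ M → t ≤ M → w ≤ M →
      Run P (t * (c * (M + 1) + 4) + 2) ⟨i, A.toCond.encode, regs n p t w⟩
        ⟨i, (PForm.conj t (F n) A).toCond.encode, regs n p t w⟩ := by
  obtain ⟨P, c, h⟩ := exists_add hF Γ
  refine ⟨.forLoop .time .row P, c, fun i A n p t w M hn hp ht hw => ?_⟩
  refine Run.forLoop (N := t) i _ (by simp) rfl rfl
    (fun k => (PForm.conj k (F n) A).toCond.encode) fun k hk => ?_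
  exact h i (PForm.conj k (F n) A) _ M rfl
    (fun r => by cases r <;> simp [regs] <;> omega)

/-- The inner loop needs the separate counter `width`, because `time` is being counted down by the
outer loop. -/
theorem exists_conj₂ {Γ : Type} {F : ℕ → ℕ → PForm}
    (hF : Printable fun ρ => F (ρ .row) (ρ .col)) :
    ∃ (P : Prog Γ) (c : ℕ), ∀ i A n p t w M, n ≤ M → p ≤ M → t ≤ M → w ≤ M →
      Run P (t * (w * (c * (M + 1) + 4) + 2 + 4) + 2) ⟨i, A.toCond.encode, regs n p t w⟩
        ⟨i, (PForm.conj₂ w F A t).toCond.encode, regs n p t w⟩ := by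
  obtain ⟨P, c, h⟩ := exists_add hF Γ
  refine ⟨.forLoop .time .row (.forLoop .width .col P), c,
    fun i A n p t w M hn hp ht hw => ?_⟩
  refine Run.forLoop (N := t) i _ (by simp) rfl rfl
    (fun k => (PForm.conj₂ w F A k).toCond.encode) fun k hk => ?_
  refine Run.forLoop (N := w) i _ (by simp) rfl rfl
    (fun j => (PForm.conj j (F k) (PForm.conj₂ w F A k)).toCond.encode) fun j hj => ?_
  exact h i (PForm.conj j (F k) (PForm.conj₂ w F A k)) _ M rfl
    (fun r => by cases r <;> simp [regs] <;> omega)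

namespace Verifier

variable {Γ K Λ σ : Type} {S : K → Type} (V : Verifier Γ K Λ σ S)

/-- For a fixed machine the lists of control states, symbols and stacks are constant; only `t` and
`j` vary, and they occur solely in unary names. -/
theorem printable_step [DecidableEq K] [Fintype K] : Printable fun ρ => V.cd.step (ρ .row) (ρ .col) := by
  have hrow : IsUnary fun ρ => ρ .row := .reg (by simp)
  have hcol : IsUnary fun ρ => ρ .col := .reg (by simp)
  have h : ∀ c o, Printable fun ρ => V.cd.transition c o (ρ .row) (ρ .col) := fun c o =>
    (Printable.eqc (.const _) hrow (.const _) _).and <|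
    (Printable.eqc (.const _) hrow (.const _) _).and <|
    (Printable.eqk (.const _) (hrow.add (.const _)) (hcol.add (.const _)) (.const _) hrow
      (hcol.add (.const _))).and <|
    Printable.all (fun i _ => Printable.eqc (.const _) (hrow.add (.const _)) (.const _) _) <|
    Printable.all (fun k _ => Printable.eqk (.const _) (hrow.add (.const _)) hcol (.const _) hrow
      hcol) <|
    Printable.eqc (.const _) (hrow.add (.const _)) (.const _) _
  exact Printable.any (fun c _ => Printable.any (fun a _ => h c _) (h c _)) (IsTemplate.const _)

theorem printable_initF [Fintype K] : Printable fun ρ => V.initF (ρ .len) (ρ .row) := by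
  have hlen : IsUnary fun ρ => ρ .len := .reg (by simp)
  have hrow : IsUnary fun ρ => ρ .row := .reg (by simp)
  exact (Printable.any (fun b _ => Printable.eqc (.const _) (.const _) (hlen.add hrow) _)
      ((Printable.eqc (.const _) (.const _) (hlen.add hrow) _).and
        (Printable.eqc (.const _) (.const _) (hlen.add (hrow.add (.const _))) _))).and
    (Printable.all (fun k _ => Printable.eqc (.const _) (.const _) hrow _) (IsTemplate.const _))

/-- The query for `V.formula` is written in polynomial time. -/
theorem exists_prog [DecidableEq K] [Fintype K] [Fintype Γ] (ρ : Restrictor) (p r : Polynomial ℕ) :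
    ∃ (P : Prog Γ) (time : Polynomial ℕ), ∀ w : List Γ,
      ∃ t ≤ time.eval w.length, Exec P t ⟨w, [], fun _ => 0⟩
        ⟨[], ((V.formula w (p.eval w.length) (r.eval w.length)).query ρ).encode, fun _ => 0⟩ := by
  -- In prefix notation the condition comes last, so the rest of the query is a constant prefix,
  -- written at the end.
  obtain ⟨pre, hpre⟩ : ∃ pre : List Token, ∀ F : PForm,
      (F.query ρ).encode = pre ++ F.toCond.encode := by
    cases ρ
    · exact ⟨_ :: _ :: _ :: Descriptor.encode _, fun F => rfl⟩
    · exact ⟨_ :: _ :: _ :: Descriptor.encode _, fun F => rfl⟩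
    · exact ⟨_ :: _ :: _ :: Descriptor.encode _, fun F => rfl⟩
  have hlen : IsUnary fun ρ => ρ .len := .reg (by simp)
  obtain ⟨P₁, c₁, h₁⟩ := exists_print (IsTemplate.const V.startF.toCond.encode) Γ
  obtain ⟨P₂, c₂, h₂⟩ := exists_addWord (F := V.inputF)
    fun a => Printable.eqc (.const _) (.const _) hlen _
  obtain ⟨P₃, q₃, h₃⟩ := exists_prog_eval (Γ := Γ) (x := .cert) (by simp) p
  obtain ⟨P₄, q₄, h₄⟩ := exists_prog_eval (Γ := Γ) (x := .time) (by simp) r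
  obtain ⟨P₅, q₅, h₅⟩ := exists_prog_eval (Γ := Γ) (x := .width) (by simp) r
  obtain ⟨P₆, c₆, h₆⟩ := exists_add (F := fun ρ => V.endF (ρ .len) (ρ .cert))
    (Printable.eqc (.const _) (.const _) (hlen.add (.reg (r := .cert) (by simp))) _) Γ
  obtain ⟨P₇, c₇, h₇⟩ := exists_add (F := fun ρ => V.acceptF (ρ .time))
    (Printable.eqc (.const _) (.reg (r := .time) (by simp)) (.const _) _) Γ
  obtain ⟨P₈, c₈, h₈⟩ := exists_conj₂ (Γ := Γ) V.printable_step
  obtain ⟨P₉, c₉, h₉⟩ := exists_conj (Γ := Γ) V.printable_initF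
  obtain ⟨P₁₀, c₁₀, h₁₀⟩ := exists_print (IsTemplate.const pre) Γ
  obtain ⟨time, htime⟩ : PolyBounded fun n =>
      c₁ * (0 + 1) + ((n * (c₂ * (n + 1) + 2) + 1) + (q₃.eval n + (q₄.eval n + (q₅.eval n +
      (c₆ * (n + p.eval n + r.eval n + 1 + 1) + (c₇ * (n + p.eval n + r.eval n + 1 + 1) +
      ((r.eval n * (r.eval n * (c₈ * (n + p.eval n + r.eval n + 1 + 1) + 4) + 2 + 4) + 2) + (1 +
      (((r.eval n + 1) * (c₉ * (n + p.eval n + r.eval n + 1 + 1) + 4) + 2) +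
      (c₁₀ * (n + p.eval n + r.eval n + 1 + 1) + ((2 * n + 1) + ((2 * p.eval n + 1) +
      ((2 * (r.eval n + 1) + 1) + (2 * r.eval n + 1)))))))))))))) := by
    repeat' first
      | with_reducible exact .id
      | with_reducible exact .const _
      | with_reducible exact .eval _
      | with_reducible apply PolyBounded.add
      | with_reducible apply PolyBounded.mul
  -- The formula is built from its innermost conjunct outwards. `time` is incremented before `P₉`
  -- because the initial row has `T + 1` conjuncts, and the counters are cleared since a halting
  -- machine must leave only its output.
  refine ⟨.seq P₁ (.seq P₂ (.seq P₃ (.seq P₄ (.seq P₅ (.seq P₆ (.seq P₇ (.seq P₈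
    (.seq (.inc .time) (.seq P₉ (.seq P₁₀ (.seq (.clear .len) (.seq (.clear .cert)
      (.seq (.clear .time) (.clear .width)))))))))))))), time, fun w => ?_⟩
  suffices Run _ _ ⟨w, [], fun _ => 0⟩ _ from this.mono (htime w.length)
  set n := w.length with hn
  -- A common bound for all counters; the final `1` accounts for the increment of `time`.
  set M := n + p.eval n + r.eval n + 1 with hM
  have hle : ∀ n' p' t' w', n' ≤ M → p' ≤ M → t' ≤ M → w' ≤ M → ∀ r, regs n' p' t' w' r ≤ M := by
    intro n' p' t' w' _ _ _ _ r
    cases r <;> simp [regs] <;> omega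
  have e₁ := (h₁ w [] (regs 0 0 0 0) 0 rfl fun r => by cases r <;> simp [regs]).of_eq
    (ξ := fun _ => 0) le_rfl rfl (List.append_nil _)
    (by intro r; cases r <;> rfl) (fun _ => rfl)
  have e₂ := h₂ w V.startF
  set A₂ := PForm.conjWord V.inputF w 0 V.startF
  have e₃ := (h₃ [] A₂.toCond.encode (regs n 0 0 0) rfl rfl rfl).of_eq
    (ξ' := regs n (p.eval n) 0 0) le_rfl rfl rfl (fun _ => rfl)
    (by intro r; cases r <;> simp [regs])
  have e₄ := (h₄ [] A₂.toCond.encode (regs n (p.eval n) 0 0) rfl rfl rfl).of_eq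
    (ξ' := regs n (p.eval n) (r.eval n) 0) le_rfl rfl rfl (fun _ => rfl)
    (by intro r; cases r <;> simp [regs])
  have e₅ := (h₅ [] A₂.toCond.encode (regs n (p.eval n) (r.eval n) 0) rfl rfl rfl).of_eq
    (ξ' := regs n (p.eval n) (r.eval n) (r.eval n)) le_rfl rfl rfl (fun _ => rfl)
    (by intro r; cases r <;> simp [regs])
  have e₆ := h₆ [] A₂ (regs n (p.eval n) (r.eval n) (r.eval n)) M rfl
    (hle _ _ _ _ (by omega) (by omega) (by omega) (by omega))
  have e₇ := h₇ [] (.and (V.endF n (p.eval n)) A₂) (regs n (p.eval n) (r.eval n) (r.eval n)) M rfl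
    (hle _ _ _ _ (by omega) (by omega) (by omega) (by omega))
  have e₈ := fun A => h₈ [] A n (p.eval n) (r.eval n) (r.eval n) M (by omega) (by omega)
    (by omega) (by omega)
  have e₈' := fun o => (Run.inc .time ([] : List Γ) o
    (regs n (p.eval n) (r.eval n) (r.eval n))).of_eq
    (ξ' := regs n (p.eval n) (r.eval n + 1) (r.eval n)) le_rfl rfl rfl (fun _ => rfl)
    (by intro r; cases r <;> simp [regs])
  have e₉ := fun A => h₉ [] A n (p.eval n) (r.eval n + 1) (r.eval n) M (by omega) (by omega)
    (by omega) (by omega)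
  have e₁₀ := fun o => h₁₀ [] o (regs n (p.eval n) (r.eval n + 1) (r.eval n)) M rfl
    (hle _ _ _ _ (by omega) (by omega) (by omega) (by omega))
  have d₁ := fun o => (Run.clear ([] : List Γ) o (r := .len)
    (regs n (p.eval n) (r.eval n + 1) (r.eval n)) rfl).of_eq
    (ξ' := regs 0 (p.eval n) (r.eval n + 1) (r.eval n)) le_rfl rfl rfl (fun _ => rfl)
    (by intro r; cases r <;> simp [regs])
  have d₂ := fun o => (Run.clear ([] : List Γ) o (r := .cert)
    (regs 0 (p.eval n) (r.eval n + 1) (r.eval n)) rfl).of_eq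
    (ξ' := regs 0 0 (r.eval n + 1) (r.eval n)) le_rfl rfl rfl (fun _ => rfl)
    (by intro r; cases r <;> simp [regs])
  have d₃ := fun o => (Run.clear ([] : List Γ) o (r := .time)
    (regs 0 0 (r.eval n + 1) (r.eval n)) rfl).of_eq
    (ξ' := regs 0 0 0 (r.eval n)) le_rfl rfl rfl (fun _ => rfl)
    (by intro r; cases r <;> simp [regs])
  have d₄ := fun o => (Run.clear ([] : List Γ) o (r := .width)
    (regs 0 0 0 (r.eval n)) rfl).of_eq
    (ξ' := fun _ => 0) le_rfl rfl rfl (fun _ => rfl)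
    (by intro r; cases r <;> simp [regs])
  rw [hpre]
  exact e₁.seq (e₂.seq (e₃.seq (e₄.seq (e₅.seq (e₆.seq (e₇.seq ((e₈ _).seq ((e₈' _).seq
    ((e₉ _).seq ((e₁₀ _).seq ((d₁ _).seq ((d₂ _).seq ((d₃ _).seq (d₄ _))))))))))))))

end Verifier

/-! ## NP-hardness -/

theorem monotone_eval (p : Polynomial ℕ) : Monotone fun n => p.eval n := fun m n h => by
  simp only [Polynomial.eval_eq_sum_range]
  gcongr

/-- The verifier given by a Turing machine that decides the pairs of a word and a certificate. -/
theorem exists_verifier {Γ : Type} [Fintype Γ] (tm : FinTM2) (inSym : tm.Γ tm.k₀ ≃ Γ ⊕ Bool)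
    (acc : tm.Γ tm.k₁) :
    haveI := tm.kFin
    ∃ V : Verifier Γ tm.K tm.Λ tm.σ tm.Γ, V.k₁ = tm.k₁ ∧ V.acc ≍ acc ∧ V.m = tm.m ∧
      ∀ w y, V.start w y = ofCfg V.m
        (initList tm ((w.map Sum.inl ++ y.map Sum.inr).map inSym.symm)) := by
  have := tm.kFin
  have := tm.ΛFin
  have := tm.σFin
  obtain ⟨cd, h₁, h₂⟩ := exists_coding tm.k₀ tm.m
    (Set.range (fun s => (⟨tm.k₀, inSym.symm s⟩ : Σ k, tm.Γ k)) ∪ {⟨tm.k₁, acc⟩})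
    ((Set.finite_range _).union (Set.finite_singleton _))
  refine ⟨⟨tm.k₀, tm.k₁, tm.m, tm.main, tm.initialState, inSym.symm, inSym.symm.injective, acc, cd,
    h₁ _ _, fun s => h₂ _ (.inl ⟨s, rfl⟩), h₂ _ (.inr rfl)⟩, rfl, .rfl, rfl, fun w y => ?_⟩
  refine congrArg (Prod.mk _) ?_
  funext k
  by_cases hk : k = tm.k₀
  · subst hk
    simp [initList]
  · simp [initList, hk]

/-- The verifier's machine halts with an encoded truth value on its output stack, so acceptance is a
statement about the top symbol of that stack, which the stack machine keeps after halting. -/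
theorem nphard_singleNode (ρ : Restrictor) :
    Complexity.NPHard (fun Q : {Q : Query // Q.IsSingleNode ρ} => Q.1.encode)
      {Q | Q.1.Satisfiable} := by
  rintro Γ _ L ⟨R, p, ⟨M⟩, hL⟩
  have := M.tm.kFin
  have := M.tm.ΛFin
  obtain ⟨V, hk, hacc, hm, hstart⟩ :=
    exists_verifier M.tm M.inputAlphabet (M.outputAlphabet.symm true)
  set D := ∑ l, size (V.m l)
  have hD : ∀ l, size (V.m l) ≤ D := fun l =>
    Finset.single_le_sum (f := fun l => size (V.m l)) (fun _ _ => Nat.zero_le _)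
      (Finset.mem_univ l)
  -- The pair of word and certificate has length at most `n + p n`, and each machine step costs at
  -- most `D` primitive steps. The summand `p` ensures that the tableau is deep enough for the
  -- certificate, `P ≤ T`.
  set r : Polynomial ℕ := M.time.comp (.X + p) * .C D + p
  have hr : ∀ n, r.eval n = M.time.eval (n + p.eval n) * D + p.eval n := fun n => by
    simp [r, Polynomial.eval_comp]
  obtain ⟨P, time, hP⟩ := V.exists_prog ρ p r
  refine ⟨fun w => ⟨(V.formula w (p.eval w.length) (r.eval w.length)).query ρ,
    PForm.isSingleNode_query ρ _⟩, P.computable _ _ time hP, fun w => ?_⟩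
  refine (hL w).trans (Iff.trans ?_ (PForm.satisfiable_query_iff ρ _).symm)
  rw [V.holds_formula_iff w (by rw [hr]; omega)]
  refine exists_congr fun y => and_congr_right fun hy => ?_
  obtain ⟨⟨s, hs⟩, hs'⟩ := M.outputsFun (w, y)
  have hlen : s ≤ M.time.eval (w.length + p.eval w.length) := by
    refine hs'.trans (monotone_eval M.time ?_)
    simp [Computability.encodingProd, Computability.encodingList, hy]
  rw [FinTM2.step, ← hm] at hs
  have h := iterate_next_of_halts V.k₀ V.m hD hs rfl (T := r.eval w.length) (by
    rw [hr]
    exact (Nat.mul_le_mul_right D hlen).trans (Nat.le_add_right _ _))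
  have hs₀ : V.start w y = ofCfg V.m (initList M.tm (List.map M.inputAlphabet.invFun
      ((Computability.encodingProd (Computability.encodingList Γ)
        (Computability.encodingList Bool)).encode (w, y)))) := hstart w y
  rw [hs₀, h]
  -- The type of `acc` depends on `k₁`, so the fields must be free variables before the equalities
  -- can be substituted.
  obtain ⟨k₀, k₁, m, main, init, inSym, hinj, acc, cd, h₁, h₂, h₃⟩ := V
  obtain rfl : k₁ = M.tm.k₁ := hk
  obtain rfl : acc = M.outputAlphabet.symm true := eq_of_heq hacc
  simp [ofCfg, haltList, Computability.encodeBool]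

/-- A reduction to a subproblem with the same encoding writes the same words, so the same machine
serves. -/
theorem NPHard.mono {α β A : Type} [Fintype A] {enc : β → List A} {S : Set β} (f : α → β)
    (h : Complexity.NPHard (fun a => enc (f a)) (f ⁻¹' S)) : Complexity.NPHard enc S := by
  intro Γ _ L hL
  obtain ⟨g, ⟨M⟩, hg⟩ := h Γ L hL
  exact ⟨fun w => f (g w), ⟨⟨M.toTM2ComputableAux, M.time, M.outputsFun⟩⟩, hg⟩

end CookLevin

theorem mainTheorem6 :
    (∀ ρ : GPC.Restrictor,
      Complexity.NPHard (fun Q : {Q : GPC.Query // Q.IsSingleNode ρ} => Q.1.encode)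
        {Q | Q.1.Satisfiable}) ∧
    Complexity.NPHard (fun Q : {Q : GPC.Query // Q.WellTyped} => Q.1.encode)
      {Q | Q.1.Satisfiable} :=
  ⟨CookLevin.nphard_singleNode, CookLevin.NPHard.mono
    (fun Q : {Q : GPC.Query // Q.IsSingleNode .simple} => ⟨Q.1, Q.2.1⟩)
    (CookLevin.nphard_singleNode .simple)⟩
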